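/- Let $\lambda,\beta\in(0,1)$. For $n\ge 1$ put $\ell=\lfloor n^{\lambda}\rfloor$ and $m=\lfloor n/\ell\rfloor$, and let $m$ consecutive blocks of length $\ell$ in $[n]=\{1,\dots,n\}$ (the tribes) be given by $\{(j-1)\ell+1,\dots,j\ell\}$, $1\le j\le m$; the remaining fewer than $\ell$ positions belong to no tribe. Let $\omega$ be uniform on $\{0,1\}^{n}$, and let $S^{\lambda}=S^\lambda_n(\omega)=\max_{1\le j\le m}\sum_{i=(j-1)\ell+1}^{j\ell}\omega_i$ be the maximal number of 1s in a tribe. For each $n\ge1$ let $q_n\in\mathbb R$ be any $\beta$-quantile of $S^\lambda_n$, that is, $\mathbb P(S^\lambda_n\le q_n)\ge\beta$ and $\mathbb P(S^\lambda_n<q_n)\le\beta$, and let $f_n=\mathbf 1_{\{S^{\lambda}_n>q_n\}}:\{0,1\}^n\to\{0,1\}$. Then: 1. $\mathbb P(f_n=0)\to\beta$ as $n\to\infty$. 2. The sequence $(f_n)_{n\ge1}$ is noise sensitive: for every $\varepsilon\in(0,1)$, if $\omega^\varepsilon$ is obtained from $\omega$ by independently resampling each coordinate with probability $\varepsilon$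 (a resampled coordinate is replaced by a fresh uniform bit), then $\mathbb E[f_n(\omega)f_n(\omega^\varepsilon)]-\mathbb E[f_n(\omega)]^2\to0$ as $n\to\infty$. 3. Let $\mathrm{Inf}_i(f_n)=\mathbb P(f_n(\omega)\ne f_n(\sigma_i\omega))$, where $\sigma_i$ flips the $i$-th coordinate. There are constants $0<c\le C<\infty$, depending only on $\lambda$ and $\beta$, such that, for all sufficiently large $n$, $$c\,\frac{\log n}{n^{1-\lambda}}\;\le\;\sum_{i=1}^n\mathrm{Inf}_i(f_n)^2\;\le\; C\,\frac{\log n}{n^{1-\lambda}}.$$ -/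

import Mathlib

open Filter Topology

namespace PolyTribes

/-- The discrete cube `{0,1}^n`; `true` stands for `1`. -/
abbrev Cube (n : ℕ) : Type := Fin n → Bool

/-- Expectation with respect to the uniform distribution on `{0,1}^n`. -/
noncomputable def expect {n : ℕ} (g : Cube n → ℝ) : ℝ :=
  (∑ ω : Cube n, g ω) / 2 ^ n

/-- Probability of an event under the uniform distribution on `{0,1}^n`. -/
noncomputable def prob {n : ℕ} (A : Set (Cube n)) : ℝ :=
  expect (A.indicator fun _ => (1 : ℝ))

/-- The value of a bit as a real number. -/
def bitVal (b : Bool) : ℝ := if b then 1 else 0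

/-- The coordinates `i` with `r i = true` are replaced by those of `ω'`, the others are kept. -/
def resample {n : ℕ} (r ω ω' : Cube n) : Cube n :=
  fun i => if r i then ω' i else ω i

/-- Probability that the set of resampled coordinates is exactly the one encoded by `r`, when each
coordinate is resampled independently with probability `ε`. -/
def maskWeight {n : ℕ} (ε : ℝ) (r : Cube n) : ℝ :=
  ∏ i, if r i then ε else 1 - ε

/-- `E[g(ω, ω^ε)]`, where `ω` is uniform and `ω^ε` is obtained from it by independently resampling
each coordinate with probability `ε`: the resampled set, `ω` and the fresh values `ω'` are
independent, and `ω`, `ω'` are uniform. -/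
noncomputable def noiseExpect {n : ℕ} (ε : ℝ) (g : Cube n → Cube n → ℝ) : ℝ :=
  ∑ r : Cube n, maskWeight ε r * expect fun ω => expect fun ω' => g ω (resample r ω ω')

/-- Noise sensitivity of a sequence of Boolean functions:
`E[f_n(ω) f_n(ω^ε)] - E[f_n(ω)]^2 → 0` for every `ε ∈ (0,1)`. -/
def NoiseSensitive (f : (n : ℕ) → Cube n → Bool) : Prop :=
  ∀ ε : ℝ, 0 < ε → ε < 1 →
    Tendsto (fun n : ℕ =>
      noiseExpect ε (fun ω η : Cube n => bitVal (f n ω) * bitVal (f n η))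
        - expect (fun ω => bitVal (f n ω)) ^ 2) atTop (𝓝 0)

/-- The operator flipping the entry at position `i`. -/
def flip {n : ℕ} (i : Fin n) (ω : Cube n) : Cube n :=
  Function.update ω i (!ω i)

/-- The influence of bit `i`: the probability that flipping it changes the outcome. -/
noncomputable def influence {n : ℕ} (f : Cube n → Bool) (i : Fin n) : ℝ :=
  prob {ω | f ω ≠ f (flip i ω)}

/-- The tribe size `⌊n^lam⌋`. -/
noncomputable def tribeSize (lam : ℝ) (n : ℕ) : ℕ := ⌊(n : ℝ) ^ lam⌋₊

/-- The number `⌊n / ⌊n^lam⌋⌋` of tribes. -/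
noncomputable def tribeCount (lam : ℝ) (n : ℕ) : ℕ := n / tribeSize lam n

/-- The number of 1s in the `j`-th block of length `l`, consisting of the (0-based) positions
`j * l, …, (j + 1) * l - 1`. -/
def blockSum {n : ℕ} (l : ℕ) (ω : Cube n) (j : ℕ) : ℕ :=
  (Finset.univ.filter fun i : Fin n => j * l ≤ (i : ℕ) ∧ (i : ℕ) < (j + 1) * l ∧ ω i = true).card

/-- The maximal number of 1s in a tribe (for `n ≥ 1` and `lam ∈ (0,1)` there is at least one
tribe). -/
noncomputable def maxTribe (lam : ℝ) {n : ℕ} (ω : Cube n) : ℕ :=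
  (Finset.range (tribeCount lam n)).sup fun j => blockSum (tribeSize lam n) ω j

/-- `q` is a `β`-quantile of the distribution of `S`: `P(S ≤ q) ≥ β` and `P(S < q) ≤ β`. -/
def IsQuantile {n : ℕ} (S : Cube n → ℝ) (β q : ℝ) : Prop :=
  β ≤ prob {ω | S ω ≤ q} ∧ prob {ω | S ω < q} ≤ β

/-- The indicator function of the event that some tribe contains more than `q` 1s. -/
noncomputable def tribesFun (lam q : ℝ) {n : ℕ} (ω : Cube n) : Bool :=
  haveI := Classical.dec (q < (maxTribe lam ω : ℝ))
  decide (q < (maxTribe lam ω : ℝ))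

end PolyTribes

/-!
Write `l` for the tribe size, `m` for the number of tribes, `k = ⌊q n⌋` and `t = P(X > k)`,
`p = P(X = k)` for a binomial variable `X` with `l` fair trials. Since tribes are independent
(`wsum_block`), `P(f = 0) = (1 - t) ^ m`, and the quantile property says exactly that
`(1 - t - p) ^ m ≤ β ≤ (1 - t) ^ m` (`IsQuantile.floor`). Hence `m t ≤ -log β` and
`1 - β ≤ m (t + p)`: the expected number of tribes above the quantile is of order one. Everything
else follows from the behaviour of binomial tails at this level.

Let `d = 2 k - l`, twice the excess of `k` over the mean. Comparing the two constraints with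
Hoeffding's inequality (`binTail_le_exp`) and with a matching lower bound (`exp_le_binTail`) shows
that `d` is of order `√(l log n)` (`excess_bounds`). The hazard rate `p / P(X ≥ k)` is of order
`d / l`: this needs no local limit theorem, because the truncated first and second moments of `X`
about its mean telescope to single binomial terms (`sum_binMass_mul_centered`,
`sum_binMass_mul_centered_sq`). So `p` is of order `d / (l m)` (`binMass_bounds`).

* As `P(max ≤ k) - P(max < k) ≤ m p`, which is of order `d / l → 0`, the probability of `f = 0`
  tends to `β`.
* The influence of a bit in a tribe is `(1 - t) ^ (m - 1) P(X' = k)`, with `X'` binomial for `l - 1`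
  trials (`influence_inl`), so it is of order `p`. There are `m l ~ n` such bits, and the sum of the
  squares is of order `d ^ 2 / (l m)`, that is, `log n / n ^ (1 - lam)`.
* The noise covariance is `J ^ m - ((1 - t) ^ 2) ^ m`, where `J` is the probability that a single
  tribe has at most `k` ones both before and after noise (`noise_covariance`). It is at most
  `m (B + t ^ 2)`, where `B` is the probability of more than `k` ones both times. The exponential
  Markov inequality bounds `B` by about `exp (-(1 + ε / 2) d ^ 2 / (2 l))`, while `t` is at least
  `exp (-(1 + o(1)) d ^ 2 / (2 l))`, so that `m B = (m t) (B / t) → 0`; hypercontractivity is not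
  needed.
-/

namespace PolyTribes

/-! ### Binomial masses and tails -/

/-- The probability `P(X = k)` for a binomial variable `X` with `l` trials of parameter `1/2`. -/
noncomputable def binMass (l k : ℕ) : ℝ := (l.choose k : ℝ) / 2 ^ l

/-- The tail `P(X ≥ k)` of a binomial variable `X` with `l` trials of parameter `1/2`. -/
noncomputable def binTail (l k : ℕ) : ℝ := ∑ j ∈ Finset.Icc k l, binMass l j

lemma binMass_nonneg (l k : ℕ) : 0 ≤ binMass l k := by
  unfold binMass; positivity

lemma binMass_eq_zero {l k : ℕ} (h : l < k) : binMass l k = 0 := by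
  simp [binMass, Nat.choose_eq_zero_of_lt h]

lemma binTail_nonneg (l k : ℕ) : 0 ≤ binTail l k :=
  Finset.sum_nonneg fun _ _ => binMass_nonneg _ _

lemma binTail_eq_add (l k : ℕ) : binTail l k = binMass l k + binTail l (k + 1) := by
  rcases le_or_gt k l with h | h
  · unfold binTail
    rw [← Finset.add_sum_Ioc_eq_sum_Icc h, ← Finset.Icc_add_one_left_eq_Ioc]
  · simp [binTail, binMass_eq_zero h, Finset.Icc_eq_empty_of_lt h,
      Finset.Icc_eq_empty_of_lt (h.trans (Nat.lt_succ_self k))]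

lemma binTail_zero (l : ℕ) : binTail l 0 = 1 := by
  have h := Nat.sum_range_choose l
  unfold binTail binMass
  rw [← Finset.sum_div, ← Nat.range_succ_eq_Icc_zero, ← Nat.cast_sum, h]
  simp

lemma binTail_anti (l : ℕ) : Antitone (binTail l) :=
  antitone_nat_of_succ_le fun k => by
    rw [binTail_eq_add l k]; linarith [binMass_nonneg l k]

lemma binTail_le_one (l k : ℕ) : binTail l k ≤ 1 :=
  (binTail_anti l (Nat.zero_le k)).trans_eq (binTail_zero l)

lemma succ_mul_binMass (l j : ℕ) :
    ((j : ℝ) + 1) * binMass l (j + 1) = ((l : ℝ) - j) * binMass l j := by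
  rcases le_or_gt j l with h | h
  · have e := Nat.choose_succ_right_eq l j
    have e' : (l.choose (j + 1) : ℝ) * (j + 1) = l.choose j * ((l : ℝ) - j) := by
      rw [← Nat.cast_sub h]; exact_mod_cast e
    unfold binMass
    rw [← mul_div_assoc, ← mul_div_assoc, mul_comm, e', mul_comm]
  · simp [binMass_eq_zero h, binMass_eq_zero (h.trans (Nat.lt_succ_self j))]

lemma sum_Icc_eq_of_telescope {l : ℕ} {g F : ℕ → ℝ} (h : ∀ j ≤ l, F j = g j + F (j + 1))
    (h0 : F (l + 1) = 0) {k : ℕ} (hk : k ≤ l + 1) : ∑ j ∈ Finset.Icc k l, g j = F k := by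
  refine Nat.decreasingInduction' (P := fun k => ∑ j ∈ Finset.Icc k l, g j = F k)
    (fun j hj _ ih => ?_) hk (by simp [h0])
  have hjl : j ≤ l := by omega
  rw [← Finset.add_sum_Ioc_eq_sum_Icc hjl, h j hjl, ← ih, ← Finset.Icc_add_one_left_eq_Ioc]

/-- The truncated first moment of a binomial variable about its mean is a single binomial term,
because `j ↦ j * P(X = j)` telescopes to it. -/
lemma sum_binMass_mul_centered {l k : ℕ} (hk : k ≤ l + 1) :
    ∑ j ∈ Finset.Icc k l, binMass l j * (2 * j - l) = k * binMass l k := by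
  refine sum_Icc_eq_of_telescope (F := fun k => k * binMass l k) (fun j _ => ?_) ?_ hk
  · have := succ_mul_binMass l j
    push_cast
    linear_combination -this
  · simp [binMass_eq_zero (Nat.lt_succ_self l)]

/-- The telescoping formula for the truncated second moment of a binomial variable about its
mean. -/
lemma sum_binMass_mul_centered_sq {l k : ℕ} (hk : k ≤ l + 1) :
    ∑ j ∈ Finset.Icc k l, binMass l j * ((2 * j - l) ^ 2 - 2 * (l - j)) =
      k * binMass l k * (2 * k - l) := by
  refine sum_Icc_eq_of_telescope (F := fun k => k * binMass l k * (2 * k - l))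
    (fun j _ => ?_) ?_ hk
  · have := succ_mul_binMass l j
    push_cast
    linear_combination -(2 * (j : ℝ) + 2 - l) * this
  · simp [binMass_eq_zero (Nat.lt_succ_self l)]

lemma mul_binTail_le {l k : ℕ} (hk : k ≤ l) :
    (2 * k - l : ℝ) * binTail l k ≤ k * binMass l k := by
  rw [← sum_binMass_mul_centered (Nat.le_succ_of_le hk), binTail, Finset.mul_sum]
  refine Finset.sum_le_sum fun j hj => ?_
  have : (k : ℝ) ≤ j := by exact_mod_cast (Finset.mem_Icc.1 hj).1
  nlinarith [binMass_nonneg l j]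

/-- An upper bound for the hazard rate beyond one standard deviation: it comes from expanding
`E[(U - 2d)² ; X ≥ k] ≥ 0`, where `U = 2X - l` and `d = 2k - l`, with the two truncated moments. -/
lemma mul_binMass_le {l k : ℕ} (hk : k ≤ l) (hd : 0 < (2 * k - l : ℝ))
    (hd2 : (l : ℝ) ≤ (2 * k - l : ℝ) ^ 2) :
    k * binMass l k ≤ 2 * (2 * k - l : ℝ) * binTail l k := by
  set d : ℝ := 2 * k - l with hdef
  have h1 := sum_binMass_mul_centered (Nat.le_succ_of_le hk)
  have h2 := sum_binMass_mul_centered_sq (Nat.le_succ_of_le hk)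
  have key : 0 ≤ ∑ j ∈ Finset.Icc k l, (binMass l j * ((2 * j - l) ^ 2 - 2 * (l - j))
      - 4 * d * (binMass l j * (2 * j - l)) + (l + 4 * d ^ 2) * binMass l j) := by
    refine Finset.sum_nonneg fun j hj => ?_
    have hkj : (k : ℝ) ≤ j := by exact_mod_cast (Finset.mem_Icc.1 hj).1
    have : binMass l j * ((2 * j - l) ^ 2 - 2 * (l - j))
      - 4 * d * (binMass l j * (2 * j - l)) + (l + 4 * d ^ 2) * binMass l j
      = binMass l j * ((2 * j - l - 2 * d) ^ 2 + (2 * j - l)) := by ring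
    rw [this]
    have : (0 : ℝ) ≤ 2 * j - l := by linarith
    exact mul_nonneg (binMass_nonneg _ _) (by positivity)
  rw [Finset.sum_add_distrib, Finset.sum_sub_distrib, ← Finset.mul_sum, ← Finset.mul_sum, h1, h2,
    ← hdef] at key
  change 0 ≤ _ + _ * binTail l k at key
  have ht := binTail_nonneg l k
  have h3 : d * (3 * (k * binMass l k)) ≤ d * (5 * d * binTail l k) := by
    nlinarith [mul_le_mul_of_nonneg_right hd2 ht]
  have h4 := le_of_mul_le_mul_left h3 hd
  nlinarith [mul_nonneg hd.le ht]

/-- Hoeffding's inequality for a binomial variable. -/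
lemma binTail_le_exp {l k : ℕ} (hl : 0 < l) (hd : 0 ≤ (2 * k - l : ℝ)) :
    binTail l k ≤ Real.exp (-(2 * k - l : ℝ) ^ 2 / (2 * l)) := by
  have hl' : (0 : ℝ) < l := by exact_mod_cast hl
  set d : ℝ := 2 * k - l with hdef
  -- the minimiser of the Gaussian bound for the moment generating function
  set s : ℝ := d / l with hs
  have hs0 : 0 ≤ s := by positivity
  have mgf : ∑ j ∈ Finset.range (l + 1), binMass l j * Real.exp (s * (2 * j - l)) =
      Real.cosh s ^ l := by
    rw [Real.cosh_eq, div_pow, add_pow, Finset.sum_div]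
    refine Finset.sum_congr rfl fun j hj => ?_
    have hj' : j ≤ l := Nat.lt_succ_iff.1 (Finset.mem_range.1 hj)
    rw [← Real.exp_nat_mul, ← Real.exp_nat_mul, ← Real.exp_add, Nat.cast_sub hj', binMass,
      show (j : ℝ) * s + ((l : ℝ) - j) * -s = s * (2 * j - l) by ring]
    ring
  have h1 : binTail l k ≤ ∑ j ∈ Finset.range (l + 1),
      Real.exp (-(s * d)) * (binMass l j * Real.exp (s * (2 * j - l))) := by
    refine (Finset.sum_le_sum fun j hj => ?_).trans
      (Finset.sum_le_sum_of_subset_of_nonneg (s := Finset.Icc k l) (fun j hj => ?_)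
        fun j _ _ => ?_)
    · have hkj : (k : ℝ) ≤ j := by exact_mod_cast (Finset.mem_Icc.1 hj).1
      rw [mul_left_comm, ← Real.exp_add]
      refine le_mul_of_one_le_right (binMass_nonneg _ _) (Real.one_le_exp ?_)
      have : 0 ≤ s * (2 * (j - k)) := mul_nonneg hs0 (by linarith)
      rw [hdef]; linarith
    · simp only [Finset.mem_Icc, Finset.mem_range] at hj ⊢; omega
    · have := binMass_nonneg l j
      positivity
  rw [← Finset.mul_sum, mgf] at h1
  refine h1.trans ?_
  have h2 : Real.cosh s ^ l ≤ Real.exp (s ^ 2 / 2) ^ l :=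
    pow_le_pow_left₀ (Real.cosh_pos s).le (Real.cosh_le_exp_half_sq s) l
  rw [← Real.exp_nat_mul] at h2
  refine (mul_le_mul_of_nonneg_left h2 (Real.exp_pos _).le).trans_eq ?_
  rw [← Real.exp_add]
  congr 1
  rw [hs]; field_simp; ring

lemma half_le_binTail {l k : ℕ} (hk : 2 * k ≤ l + 1) : 1 / 2 ≤ binTail l k := by
  have hsplit : ∑ j ∈ Finset.range k, binMass l j + binTail l k = 1 := by
    rw [← binTail_zero l, binTail, binTail, ← Nat.range_succ_eq_Icc_zero,
      ← Finset.sum_range_add_sum_Ico _ (show k ≤ l + 1 by omega)]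
    rfl
  have hrefl : ∑ j ∈ Finset.range k, binMass l j ≤ binTail l k := by
    have : ∑ j ∈ Finset.range k, binMass l j =
        ∑ j ∈ (Finset.range k).image (fun j => l - j), binMass l j := by
      rw [Finset.sum_image]
      · refine Finset.sum_congr rfl fun j hj => ?_
        have := Finset.mem_range.1 hj
        rw [binMass, binMass, Nat.choose_symm (by omega)]
      · intro a ha b hb hab
        simp only [Finset.coe_range, Set.mem_Iio] at ha hb hab
        omega
    rw [this]
    refine Finset.sum_le_sum_of_subset_of_nonneg (fun j hj => ?_) fun _ _ _ => binMass_nonneg _ _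
    simp only [Finset.mem_image, Finset.mem_range, Finset.mem_Icc] at hj ⊢
    omega
  linarith

lemma exp_neg_le_one_sub {δ v : ℝ} (hδ : 0 < δ) (hv0 : 0 ≤ v) (hv : v ≤ δ / (1 + δ)) :
    Real.exp (-((1 + δ) * v)) ≤ 1 - v := by
  have h1 : v * (1 + δ) ≤ δ := (le_div_iff₀ (by linarith)).1 hv
  have hv1 : 0 < 1 - v := by nlinarith
  have h2 := Real.add_one_le_exp ((1 + δ) * v)
  rw [Real.exp_neg, inv_le_comm₀ (Real.exp_pos _) hv1]
  refine le_trans ?_ h2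
  rw [inv_le_iff_one_le_mul₀ hv1]
  nlinarith

/-- Beyond the mean, the binomial masses decay essentially no faster than Gaussian ones. -/
lemma binMass_mul_exp_le {l j s : ℕ} {δ D : ℝ} (hδ : 0 < δ) (hl : 0 < l)
    (hj : (0 : ℝ) ≤ 2 * j - l) (hD : 2 * D + 2 ≤ δ / (1 + δ) * l)
    (hs : (2 * (j + s) - l : ℝ) ≤ D) :
    binMass l j * Real.exp (-((1 + δ) * ((2 * (j + s) - l : ℝ) ^ 2 - (2 * j - l) ^ 2) / (2 * l)))
      ≤ binMass l (j + s) := by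
  have hl' : (0 : ℝ) < l := by exact_mod_cast hl
  induction s with
  | zero => simp
  | succ s ih =>
    push_cast at hs
    have ih := ih (by linarith)
    set u : ℝ := 2 * (j + s) - l with hu
    have hu0 : 0 ≤ u := by have : (0 : ℝ) ≤ s := by positivity
                           linarith
    have hr := succ_mul_binMass l (j + s)
    have hv : (2 * u + 2) / l ≤ δ / (1 + δ) := by
      rw [div_le_iff₀ hl']; linarith
    have he := exp_neg_le_one_sub hδ (by positivity) hv
    have hstep : (1 - (2 * u + 2) / l) * binMass l (j + s) ≤ binMass l (j + s + 1) := by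
      have e1 : binMass l (j + s + 1) = (l - u) / (l + u + 2) * binMass l (j + s) := by
        push_cast at hr
        rw [div_mul_eq_mul_div, eq_div_iff (by positivity)]
        rw [hu]; linear_combination 2 * hr
      rw [e1]
      refine mul_le_mul_of_nonneg_right ?_ (binMass_nonneg _ _)
      have : (l - u) / (l + u + 2) = 1 - (2 * u + 2) / (l + u + 2) := by
        field_simp; ring
      rw [this]
      gcongr
      linarith
    calc _ = binMass l j * Real.exp (-((1 + δ) * (u ^ 2 - (2 * j - l) ^ 2) / (2 * l)))
          * Real.exp (-((1 + δ) * ((2 * u + 2) / l))) := by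
          rw [mul_assoc, ← Real.exp_add]
          congr 2
          rw [hu]; push_cast; field_simp; ring
      _ ≤ binMass l (j + s) * (1 - (2 * u + 2) / l) :=
          mul_le_mul ih he (Real.exp_pos _).le (binMass_nonneg _ _)
      _ ≤ _ := by rw [mul_comm]; exact hstep

/-- A lower bound for binomial tails with the sharp constant in the Gaussian exponent. At least a
quarter of the mass sits within one standard deviation above the mean; shifting this window to
start at `K` costs a factor that is controlled by the decay of the masses. -/
lemma exp_le_binTail {l K : ℕ} {δ D : ℝ} (hδ : 0 < δ) (hl : 0 < l)
    (hK : (2 * K - l : ℝ) + 2 * √l ≤ D) (hD : 2 * D + 2 ≤ δ / (1 + δ) * l) :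
    1 / 4 * Real.exp (-((1 + δ) * D ^ 2 / (2 * l))) ≤ binTail l K := by
  have hl' : (0 : ℝ) < l := by exact_mod_cast hl
  rcases le_or_gt (2 * K) (l + 1) with hKl | hKl
  · have h1 := half_le_binTail hKl
    have : Real.exp (-((1 + δ) * D ^ 2 / (2 * l))) ≤ 1 :=
      Real.exp_le_one_iff.2 (neg_nonpos.2 (by positivity))
    linarith
  set j0 := (l + 1) / 2 with hj0
  obtain ⟨s, hs⟩ : ∃ s, K = j0 + s := ⟨K - j0, by omega⟩
  have hj0l : (l : ℝ) ≤ 2 * j0 := by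
    have : l ≤ 2 * j0 := by omega
    exact_mod_cast this
  set J := ⌈((l : ℝ) + 2 * √l) / 2⌉₊ with hJ
  have hJ1 : ((l : ℝ) + 2 * √l) / 2 ≤ J := Nat.le_ceil _
  have hsq : 0 < √(l : ℝ) := Real.sqrt_pos.2 hl'
  have hsq2 : √(l : ℝ) ^ 2 = l := Real.sq_sqrt hl'.le
  have hlow : 1 / 2 ≤ binTail l j0 := half_le_binTail (by omega)
  have hup : binTail l J ≤ 1 / 4 := by
    refine (binTail_le_exp hl (by linarith)).trans ?_
    have h4 : -(2 * J - l : ℝ) ^ 2 / (2 * l) ≤ -2 := by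
      rw [div_le_iff₀ (by positivity)]
      nlinarith
    refine (Real.exp_le_exp.2 h4).trans ?_
    have h2 : (2 : ℝ) ≤ Real.exp 1 := by linarith [Real.add_one_le_exp (1 : ℝ)]
    rw [Real.exp_neg, show (2 : ℝ) = 1 + 1 by norm_num, Real.exp_add,
      inv_le_comm₀ (by positivity) (by norm_num)]
    nlinarith
  have hwin : 1 / 4 ≤ ∑ j ∈ Finset.Ico j0 J, binMass l j := by
    have : binTail l j0 ≤ ∑ j ∈ Finset.Ico j0 J, binMass l j + binTail l J := by
      rw [binTail, binTail]
      calc _ ≤ ∑ j ∈ Finset.Ico j0 J ∪ Finset.Icc J l, binMass l j := by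
            refine Finset.sum_le_sum_of_subset_of_nonneg (fun j hj => ?_)
              fun _ _ _ => binMass_nonneg _ _
            simp only [Finset.mem_union, Finset.mem_Ico, Finset.mem_Icc] at hj ⊢
            omega
        _ = _ := Finset.sum_union (Finset.disjoint_left.2 fun j h1 h2 => by
            simp only [Finset.mem_Ico, Finset.mem_Icc] at h1 h2; omega)
    linarith
  have hrange : ∀ j ∈ Finset.Ico j0 J, (0 : ℝ) ≤ 2 * j - l ∧ (2 * (j + s) - l : ℝ) ≤ D := by
    intro j hj
    obtain ⟨h1, h2⟩ := Finset.mem_Ico.1 hj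
    have h1' : (j0 : ℝ) ≤ j := by exact_mod_cast h1
    have h2' := Nat.lt_ceil.1 h2
    have h3 : (K : ℝ) = j0 + s := by exact_mod_cast hs
    constructor <;> linarith
  calc _ ≤ (∑ j ∈ Finset.Ico j0 J, binMass l j) * Real.exp (-((1 + δ) * D ^ 2 / (2 * l))) :=
        mul_le_mul_of_nonneg_right hwin (Real.exp_pos _).le
    _ ≤ ∑ j ∈ Finset.Ico j0 J, binMass l (j + s) := by
        rw [Finset.sum_mul]
        refine Finset.sum_le_sum fun j hj => ?_
        obtain ⟨h1, h2⟩ := hrange j hj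
        refine le_trans ?_ (binMass_mul_exp_le hδ hl h1 hD h2)
        refine mul_le_mul_of_nonneg_left (Real.exp_le_exp.2 (neg_le_neg ?_)) (binMass_nonneg _ _)
        have hs0 : (0 : ℝ) ≤ s := by positivity
        gcongr
        nlinarith
    _ = ∑ j ∈ (Finset.Ico j0 J).map (addRightEmbedding s), binMass l j := by
        rw [Finset.sum_map]; rfl
    _ ≤ _ := by
        refine Finset.sum_le_sum_of_subset_of_nonneg (fun i hi => ?_)
          fun _ _ _ => binMass_nonneg _ _
        simp only [Finset.mem_map, addRightEmbedding_apply] at hi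
        obtain ⟨j, hj, rfl⟩ := hi
        obtain ⟨-, h2⟩ := hrange j hj
        have h3 : δ / (1 + δ) * l ≤ l := by
          refine mul_le_of_le_one_left hl'.le ((div_le_one (by linarith)).2 (by linarith))
        have hle : (j + s : ℝ) ≤ l := by linarith
        have hle' : j + s ≤ l := by exact_mod_cast hle
        have := (Finset.mem_Ico.1 hj).1
        exact Finset.mem_Icc.2 ⟨by omega, hle'⟩

/-! ### Product measures on finite products -/

/-- The expectation of `g` under the product measure on `ι → α` whose factors have weights `w`.
No normalisation or positivity of `w` is built in. -/
def wsum {ι α : Type*} [Fintype ι] [DecidableEq ι] [Fintype α] (w : α → ℝ) (g : (ι → α) → ℝ) : ℝ :=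
  ∑ z : ι → α, (∏ i, w (z i)) * g z

/-- The weights of a fair bit. -/
noncomputable def fairWeight : Bool → ℝ := fun _ => 1 / 2

section Weighted

variable {ι α β : Type*} [Fintype ι] [DecidableEq ι] [Fintype α] [Fintype β]

lemma wsum_add (w : α → ℝ) (g h : (ι → α) → ℝ) :
    wsum w (fun z => g z + h z) = wsum w g + wsum w h := by
  simp [wsum, mul_add, Finset.sum_add_distrib]

lemma wsum_sub (w : α → ℝ) (g h : (ι → α) → ℝ) :
    wsum w (fun z => g z - h z) = wsum w g - wsum w h := by
  simp [wsum, mul_sub, Finset.sum_sub_distrib]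

lemma wsum_const_mul (w : α → ℝ) (c : ℝ) (g : (ι → α) → ℝ) :
    wsum w (fun z => c * g z) = c * wsum w g := by
  simp only [wsum, Finset.mul_sum]
  exact Finset.sum_congr rfl fun z _ => by ring

lemma wsum_prod (w u : α → ℝ) :
    wsum w (fun z : ι → α => ∏ i, u (z i)) = (∑ a, w a * u a) ^ Fintype.card ι := by
  classical
  rw [← Finset.card_univ, ← Finset.prod_const, Fintype.prod_sum]
  exact Finset.sum_congr rfl fun z _ => Finset.prod_mul_distrib.symm

lemma wsum_one {w : α → ℝ} (hw : ∑ a, w a = 1) : wsum w (fun _ : ι → α => 1) = 1 := by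
  have := wsum_prod (ι := ι) w fun _ => 1
  simpa [hw] using this

lemma wsum_mono {w : α → ℝ} (hw : ∀ a, 0 ≤ w a) {g h : (ι → α) → ℝ} (hgh : ∀ z, g z ≤ h z) :
    wsum w g ≤ wsum w h :=
  Finset.sum_le_sum fun z _ =>
    mul_le_mul_of_nonneg_left (hgh z) (Finset.prod_nonneg fun _ _ => hw _)

lemma wsum_nonneg {w : α → ℝ} (hw : ∀ a, 0 ≤ w a) {g : (ι → α) → ℝ} (hg : ∀ z, 0 ≤ g z) :
    0 ≤ wsum w g :=
  Finset.sum_nonneg fun z _ => mul_nonneg (Finset.prod_nonneg fun _ _ => hw _) (hg z)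

/-- Image measures of product measures under a coordinatewise map. -/
lemma wsum_comp [DecidableEq β] {w : α → ℝ} {v : β → ℝ} (π : α → β)
    (hv : ∀ b, ∑ a with π a = b, w a = v b) (g : (ι → β) → ℝ) :
    wsum w (fun z : ι → α => g fun i => π (z i)) = wsum v g := by
  classical
  unfold wsum
  rw [← Finset.sum_fiberwise Finset.univ (fun z : ι → α => fun i => π (z i))]
  refine Finset.sum_congr rfl fun y _ => ?_
  simp_rw [← hv]
  rw [Finset.prod_univ_sum, Finset.sum_mul]
  refine Finset.sum_congr ?_ fun z hz => ?_
  · ext z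
    simp [Fintype.mem_piFinset, funext_iff]
  · rw [← (funext_iff.2 fun i => (Finset.mem_filter.1 (Fintype.mem_piFinset.1 hz i)).2)]

end Weighted

section Blocks

variable {n m l r : ℕ} {α : Type*}

/-- The restriction of `z` to the `j`-th block of coordinates, where `e` arranges the coordinates
into `m` blocks of length `l` and a remainder. -/
def block (e : (Fin m × Fin l) ⊕ Fin r ≃ Fin n) (z : Fin n → α) (j : Fin m) : Fin l → α :=
  fun i => z (e (.inl (j, i)))

/-- Disjoint blocks are independent. -/
lemma wsum_block [Fintype α] (e : (Fin m × Fin l) ⊕ Fin r ≃ Fin n) {w : α → ℝ}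
    (hw : ∑ a, w a = 1) (G : Fin m → (Fin l → α) → ℝ) :
    wsum w (fun z : Fin n → α => ∏ j, G j (block e z j)) = ∏ j, wsum w (G j) := by
  classical
  let E : (Fin n → α) ≃ (Fin m → Fin l → α) × (Fin r → α) :=
    ((Equiv.arrowCongr e.symm (Equiv.refl α)).trans (Equiv.sumArrowEquivProdArrow _ _ _)).trans
      (Equiv.prodCongr (Equiv.curry _ _ _) (Equiv.refl _))
  have h1 : wsum w (fun z : Fin n → α => ∏ j, G j (block e z j)) =
      ∑ p : (Fin m → Fin l → α) × (Fin r → α),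
        (∏ i, w (p.2 i)) * ∏ j, ((∏ i, w (p.1 j i)) * G j (p.1 j)) := by
    refine Fintype.sum_equiv E _ _ fun z => ?_
    have h2 : ∏ i, w (z i) = (∏ j, ∏ i, w ((E z).1 j i)) * ∏ i, w ((E z).2 i) := by
      rw [← e.prod_comp, Fintype.prod_sum_type, Fintype.prod_prod_type]
      rfl
    rw [h2, Finset.prod_mul_distrib]
    change _ * ∏ j, G j ((E z).1 j) = _
    ring
  rw [h1, Fintype.sum_prod_type, Finset.sum_comm]
  simp_rw [← Finset.mul_sum]
  rw [← Finset.sum_mul]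
  have h3 : ∑ y : Fin r → α, ∏ i, w (y i) = 1 := by
    simpa [wsum] using wsum_one (ι := Fin r) hw
  rw [h3, one_mul]
  exact (Fintype.prod_sum fun j (y : Fin l → α) => (∏ i, w (y i)) * G j y).symm

end Blocks

/-! ### The number of ones among fair bits -/

/-- The number of 1s in a bit vector. -/
def ones {ι : Type*} [Fintype ι] (y : ι → Bool) : ℕ := (Finset.univ.filter fun i => y i = true).card

/-- The number of 1s in a vector of fair bits is binomial. -/
lemma wsum_fair_ones (l : ℕ) (φ : ℕ → ℝ) :
    wsum fairWeight (fun y : Fin l → Bool => φ (ones y)) =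
      ∑ j ∈ Finset.range (l + 1), binMass l j * φ j := by
  have h1 : ∑ y : Fin l → Bool, φ (ones y) =
      ∑ s ∈ (Finset.univ : Finset (Fin l)).powerset, φ s.card := by
    refine Finset.sum_nbij' (fun y => Finset.univ.filter fun i => y i = true)
      (fun s i => decide (i ∈ s)) ?_ ?_ ?_ ?_ ?_
    · simp
    · simp
    · intro y _; ext i; simp
    · intro s _; ext i; simp
    · intro y _; rfl
  have h2 := Finset.sum_powerset_apply_card φ (x := (Finset.univ : Finset (Fin l)))
  rw [Finset.card_univ, Fintype.card_fin] at h2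
  simp only [wsum, fairWeight, Finset.prod_const, Finset.card_univ, Fintype.card_fin]
  rw [← Finset.mul_sum, h1, h2, Finset.mul_sum]
  refine Finset.sum_congr rfl fun j _ => ?_
  simp only [binMass, nsmul_eq_mul, one_div, inv_pow]
  ring

lemma sum_fairWeight : ∑ b, fairWeight b = 1 := by simp [fairWeight]

lemma wsum_fair_le (l k : ℕ) :
    wsum fairWeight (fun y : Fin l → Bool => if ones y ≤ k then (1 : ℝ) else 0) =
      1 - binTail l (k + 1) := by
  have h0 := binTail_zero l
  rw [binTail, ← Nat.range_succ_eq_Icc_zero] at h0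
  have h1 : binTail l (k + 1) =
      ∑ j ∈ Finset.range (l + 1), binMass l j * if ¬ j ≤ k then (1 : ℝ) else 0 := by
    simp only [mul_ite, mul_one, mul_zero]
    rw [← Finset.sum_filter]
    refine Finset.sum_congr ?_ fun _ _ => rfl
    ext j; simp only [Finset.mem_Icc, Finset.mem_filter, Finset.mem_range]; omega
  rw [wsum_fair_ones l fun j => if j ≤ k then (1 : ℝ) else 0, eq_sub_iff_add_eq, h1,
    ← Finset.sum_add_distrib]
  refine (Finset.sum_congr rfl fun j _ => ?_).trans h0
  by_cases h : j ≤ k <;> simp [h]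

lemma ones_insertNth {l : ℕ} (i : Fin (l + 1)) (b : Bool) (y : Fin l → Bool) :
    ones (Fin.insertNth i b y : Fin (l + 1) → Bool) = (if b then 1 else 0) + ones y := by
  unfold ones
  rw [Finset.card_filter, Finset.card_filter, Fin.sum_univ_succAbove _ i]
  simp

/-- A bit decides whether a vector of `l + 1` fair bits has more than `k` ones exactly if there are
`k` ones among the other bits. -/
lemma wsum_fair_pivotal (l k : ℕ) (i : Fin (l + 1)) :
    wsum fairWeight (fun y : Fin (l + 1) → Bool =>
      if ¬ (ones y ≤ k ↔ ones (flip i y) ≤ k) then (1 : ℝ) else 0) = binMass l k := by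
  have h1 : ∀ (b : Bool) (y : Fin l → Bool),
      (¬ (ones (Fin.insertNth i b y : Fin (l + 1) → Bool) ≤ k ↔
        ones (flip i (Fin.insertNth i b y : Fin (l + 1) → Bool)) ≤ k)) ↔ ones y = k := by
    intro b y
    have : flip i (Fin.insertNth i b y : Fin (l + 1) → Bool) = Fin.insertNth i (!b) y := by
      unfold flip
      rw [Fin.insertNth_apply_same, Fin.update_insertNth]
    rw [this, ones_insertNth, ones_insertNth]
    cases b <;> simp <;> omega
  have h2 : wsum fairWeight (fun y : Fin l → Bool => if ones y = k then (1 : ℝ) else 0) =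
      binMass l k := by
    rw [wsum_fair_ones l fun j => if j = k then (1 : ℝ) else 0]
    simp only [mul_ite, mul_one, mul_zero, Finset.sum_ite_eq', Finset.mem_range]
    split_ifs with h
    · rfl
    · exact (binMass_eq_zero (by omega)).symm
  rw [← h2]
  unfold wsum
  rw [← (Fin.insertNthEquiv (fun _ => Bool) i).sum_comp, Fintype.sum_prod_type]
  simp only [Fin.insertNthEquiv, Equiv.coe_fn_mk, h1, fairWeight, Finset.prod_const,
    Finset.card_univ, Fintype.card_fin, Fintype.sum_bool]
  rw [← Finset.sum_add_distrib]
  refine Finset.sum_congr rfl fun y _ => ?_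
  ring

lemma expect_eq_wsum {n : ℕ} (g : Cube n → ℝ) : expect g = wsum fairWeight g := by
  simp only [expect, wsum, fairWeight, Finset.prod_const, Finset.card_univ, Fintype.card_fin]
  rw [← Finset.mul_sum]
  simp only [one_div, inv_pow]
  ring

lemma prob_eq_wsum {n : ℕ} (p : Cube n → Prop) [DecidablePred p] :
    prob {ω | p ω} = wsum fairWeight (fun ω => if p ω then (1 : ℝ) else 0) := by
  rw [prob, expect_eq_wsum]
  congr 1
  ext ω
  simp [Set.indicator_apply]

lemma prob_mono {n : ℕ} {A B : Set (Cube n)} (h : A ⊆ B) : prob A ≤ prob B := by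
  rw [prob, prob, expect_eq_wsum, expect_eq_wsum]
  exact wsum_mono (fun _ => by simp [fairWeight]) fun ω =>
    Set.indicator_le_indicator_of_subset h (fun _ => zero_le_one) ω

/-! ### Blocks under the uniform measure and under noise -/

section Tribes

variable {n m l r : ℕ} (e : (Fin m × Fin l) ⊕ Fin r ≃ Fin n)

lemma ite_forall_eq_prod {m : ℕ} (p : Fin m → Prop) [DecidablePred p] :
    (if ∀ j, p j then (1 : ℝ) else 0) = ∏ j, if p j then (1 : ℝ) else 0 := by
  rw [Finset.prod_ite_zero]
  simp

/-- The probability that no tribe has more than `k` ones. -/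
lemma prob_forall_block_le (k : ℕ) :
    prob {ω : Cube n | ∀ j, ones (block e ω j) ≤ k} = (1 - binTail l (k + 1)) ^ m := by
  rw [prob_eq_wsum]
  simp_rw [ite_forall_eq_prod]
  rw [wsum_block e sum_fairWeight fun _ y => if ones y ≤ k then (1 : ℝ) else 0]
  simp [wsum_fair_le]

lemma block_flip_of_ne {j j' : Fin m} (hj : j' ≠ j) (i : Fin l) (ω : Cube n) :
    block e (flip (e (.inl (j, i))) ω) j' = block e ω j' := by
  ext i'
  have : e (.inl (j', i')) ≠ e (.inl (j, i)) := by simp [hj]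
  simp only [block, flip, Function.update_of_ne this]

lemma block_flip_self (j : Fin m) (i : Fin l) (ω : Cube n) :
    block e (flip (e (.inl (j, i))) ω) j = flip i (block e ω j) := by
  ext i'
  simp only [block, flip, Function.update_apply, EmbeddingLike.apply_eq_iff_eq, Sum.inl.injEq,
    Prod.mk.injEq, true_and]

lemma block_flip_inr (j : Fin m) (i : Fin r) (ω : Cube n) :
    block e (flip (e (.inr i)) ω) j = block e ω j := by
  ext i'
  simp [block, flip]

variable {k : ℕ} {f : Cube n → Bool}

lemma influence_inr (hf : ∀ ω, f ω = false ↔ ∀ j, ones (block e ω j) ≤ k) (i : Fin r) :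
    influence f (e (.inr i)) = 0 := by
  have : ∀ ω, f ω = f (flip (e (.inr i)) ω) := by
    intro ω
    have h1 : f ω = false ↔ f (flip (e (.inr i)) ω) = false := by
      rw [hf, hf]
      simp only [block_flip_inr]
    cases h : f ω <;> cases h' : f (flip (e (.inr i)) ω) <;> simp [h, h'] at h1 ⊢
  simp [influence, ← this, prob, expect]

/-- A bit of a tribe is pivotal iff no other tribe has more than `k` ones and its tribe has exactly
`k` ones besides it. -/
lemma influence_inl (hf : ∀ ω, f ω = false ↔ ∀ j, ones (block e ω j) ≤ k) (j : Fin m)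
    (i : Fin l) :
    influence f (e (.inl (j, i))) = (1 - binTail l (k + 1)) ^ (m - 1) * binMass (l - 1) k := by
  classical
  obtain ⟨l, rfl⟩ : ∃ l', l = l' + 1 := ⟨l - 1, by have := i.isLt; omega⟩
  let G : Fin m → (Fin (l + 1) → Bool) → ℝ := fun j' y =>
    if j' = j then (if ¬ (ones y ≤ k ↔ ones (flip i y) ≤ k) then (1 : ℝ) else 0)
    else if ones y ≤ k then (1 : ℝ) else 0
  have key : ∀ ω, (if f ω ≠ f (flip (e (.inl (j, i))) ω) then (1 : ℝ) else 0) =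
      ∏ j', G j' (block e ω j') := by
    intro ω
    have hG : ∏ j', G j' (block e ω j') = ∏ j', if (if j' = j then
        (¬ (ones (block e ω j') ≤ k ↔ ones (flip i (block e ω j')) ≤ k)) else
        ones (block e ω j') ≤ k) then (1 : ℝ) else 0 := by
      refine Finset.prod_congr rfl fun j' _ => ?_
      simp only [G]
      split_ifs <;> simp_all
    rw [hG, ← ite_forall_eq_prod]
    refine if_congr ?_ rfl rfl
    have h1 := hf ω
    have h2 := hf (flip (e (.inl (j, i))) ω)
    have h3 : ∀ ω', (∀ j', ones (block e ω' j') ≤ k) ↔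
        (∀ j', j' ≠ j → ones (block e ω' j') ≤ k) ∧ ones (block e ω' j) ≤ k := by
      intro ω'
      refine ⟨fun h => ⟨fun j' _ => h j', h j⟩, fun h j' => ?_⟩
      by_cases hj : j' = j
      · exact hj ▸ h.2
      · exact h.1 j' hj
    have h4 : (∀ j', j' ≠ j → ones (block e (flip (e (.inl (j, i))) ω) j') ≤ k) ↔
        (∀ j', j' ≠ j → ones (block e ω j') ≤ k) :=
      forall_congr' fun j' => imp_congr_right fun hj => by rw [block_flip_of_ne e hj]
    rw [h3] at h1 h2
    rw [h4, block_flip_self] at h2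
    have h5 : (∀ j', if j' = j then
        (¬ (ones (block e ω j') ≤ k ↔ ones (flip i (block e ω j')) ≤ k)) else
        ones (block e ω j') ≤ k) ↔ (∀ j', j' ≠ j → ones (block e ω j') ≤ k) ∧
        ¬ (ones (block e ω j) ≤ k ↔ ones (flip i (block e ω j)) ≤ k) := by
      refine ⟨fun h => ⟨fun j' hj => by simpa [hj] using h j', by simpa using h j⟩,
        fun h j' => ?_⟩
      by_cases hj : j' = j
      · subst hj; simpa using h.2
      · simpa [hj] using h.1 j' hj
    rw [h5]
    cases hfa : f ω <;> cases hfb : f (flip (e (.inl (j, i))) ω) <;>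
      simp only [hfa, hfb, true_iff, false_iff, Bool.true_eq_false] at h1 h2 <;> simp <;> tauto
  rw [influence, prob_eq_wsum]
  simp_rw [key]
  rw [wsum_block e sum_fairWeight, ← Finset.mul_prod_erase _ _ (Finset.mem_univ j)]
  have hA : wsum fairWeight (G j) = binMass l k := by
    simp only [G, if_true]; exact wsum_fair_pivotal l k i
  have hB : ∀ j' ∈ Finset.univ.erase j, wsum fairWeight (G j') = 1 - binTail (l + 1) (k + 1) := by
    intro j' hj'
    simp only [G, (Finset.mem_erase.1 hj').1, if_false]; exact wsum_fair_le (l + 1) k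
  rw [hA, Finset.prod_congr rfl hB, Finset.prod_const, Finset.card_erase_of_mem (Finset.mem_univ j)]
  simp [mul_comm]

lemma sum_influence_sq (hf : ∀ ω, f ω = false ↔ ∀ j, ones (block e ω j) ≤ k) :
    ∑ i, influence f i ^ 2 =
      (m * l : ℝ) * ((1 - binTail l (k + 1)) ^ (m - 1) * binMass (l - 1) k) ^ 2 := by
  rw [← e.sum_comp, Fintype.sum_sum_type, Fintype.sum_prod_type]
  simp only [influence_inl e hf, influence_inr e hf]
  simp
  ring

/-- The joint weights of a resampling mark, an old bit and a fresh bit. -/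
noncomputable def noiseWeight (ε : ℝ) (a : Bool × Bool × Bool) : ℝ :=
  (if a.1 then ε else 1 - ε) / 4

/-- The bit after resampling. -/
def newBit (a : Bool × Bool × Bool) : Bool := if a.1 then a.2.2 else a.2.1

lemma noiseExpect_eq_wsum {n : ℕ} (ε : ℝ) (g : Cube n → Cube n → ℝ) :
    noiseExpect ε g = wsum (noiseWeight ε) (fun z : Fin n → Bool × Bool × Bool =>
      g (fun i => (z i).2.1) fun i => newBit (z i)) := by
  let E : (Fin n → Bool × Bool × Bool) ≃ Cube n × Cube n × Cube n :=
    (Equiv.arrowProdEquivProdArrow _ _ _).trans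
      (Equiv.prodCongr (Equiv.refl _) (Equiv.arrowProdEquivProdArrow _ _ _))
  have h1 : wsum (noiseWeight ε) (fun z : Fin n → Bool × Bool × Bool =>
      g (fun i => (z i).2.1) fun i => newBit (z i)) = ∑ p : Cube n × Cube n × Cube n,
        maskWeight ε p.1 / 2 ^ n / 2 ^ n * g p.2.1 (resample p.1 p.2.1 p.2.2) := by
    refine Fintype.sum_equiv E _ _ fun z => ?_
    have h2 : ∏ i, noiseWeight ε (z i) = maskWeight ε (E z).1 / 2 ^ n / 2 ^ n := by
      simp only [noiseWeight, Finset.prod_div_distrib, Finset.prod_const, Finset.card_univ,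
        Fintype.card_fin]
      rw [div_div, ← mul_pow]
      norm_num
      rfl
    rw [h2]
    rfl
  rw [h1, Fintype.sum_prod_type]
  refine Finset.sum_congr rfl fun s _ => ?_
  rw [Fintype.sum_prod_type]
  simp only [expect, ← Finset.mul_sum]
  rw [Finset.mul_sum, Finset.sum_div, Finset.mul_sum]
  refine Finset.sum_congr rfl fun ω _ => ?_
  ring

lemma sum_noiseWeight (ε : ℝ) : ∑ a, noiseWeight ε a = 1 := by
  simp [noiseWeight, Fintype.sum_prod_type]; ring

lemma noiseWeight_nonneg {ε : ℝ} (h0 : 0 ≤ ε) (h1 : ε ≤ 1) (a : Bool × Bool × Bool) :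
    0 ≤ noiseWeight ε a := by
  unfold noiseWeight
  split_ifs <;> linarith

lemma wsum_noise_old {n : ℕ} (ε : ℝ) (g : (Fin n → Bool) → ℝ) :
    wsum (noiseWeight ε) (fun z : Fin n → Bool × Bool × Bool => g fun i => (z i).2.1) =
      wsum fairWeight g := by
  refine wsum_comp (fun a : Bool × Bool × Bool => a.2.1) (fun b => ?_) g
  cases b <;> simp [Finset.sum_filter, noiseWeight, fairWeight, Fintype.sum_prod_type] <;> ring

lemma wsum_noise_new {n : ℕ} (ε : ℝ) (g : (Fin n → Bool) → ℝ) :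
    wsum (noiseWeight ε) (fun z : Fin n → Bool × Bool × Bool => g fun i => newBit (z i)) =
      wsum fairWeight g := by
  refine wsum_comp newBit (fun b => ?_) g
  cases b <;>
    simp [Finset.sum_filter, noiseWeight, fairWeight, Fintype.sum_prod_type, newBit] <;> ring

/-- The probability that a tribe of length `l` has more than `k` ones both before and after noise
of intensity `ε`. -/
noncomputable def jointTail (ε : ℝ) (l k : ℕ) : ℝ :=
  wsum (noiseWeight ε) fun z : Fin l → Bool × Bool × Bool =>
    if k < ones (fun i => (z i).2.1) ∧ k < ones (fun i => newBit (z i)) then (1 : ℝ) else 0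

lemma wsum_noise_le (ε : ℝ) (l k : ℕ) :
    (wsum (noiseWeight ε) fun z : Fin l → Bool × Bool × Bool =>
      (if ones (fun i => (z i).2.1) ≤ k then (1 : ℝ) else 0) *
        if ones (fun i => newBit (z i)) ≤ k then (1 : ℝ) else 0) =
      1 - 2 * binTail l (k + 1) + jointTail ε l k := by
  have h0 := wsum_one (ι := Fin l) (sum_noiseWeight ε)
  have h1 := wsum_noise_old ε fun y : Fin l → Bool => if ones y ≤ k then (1 : ℝ) else 0
  have h2 := wsum_noise_new ε fun y : Fin l → Bool => if ones y ≤ k then (1 : ℝ) else 0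
  rw [wsum_fair_le] at h1 h2
  have : (fun z : Fin l → Bool × Bool × Bool =>
      (if ones (fun i => (z i).2.1) ≤ k then (1 : ℝ) else 0) *
        if ones (fun i => newBit (z i)) ≤ k then (1 : ℝ) else 0) = fun z =>
      (((if ones (fun i => (z i).2.1) ≤ k then (1 : ℝ) else 0) +
        if ones (fun i => newBit (z i)) ≤ k then (1 : ℝ) else 0) - 1) +
      if k < ones (fun i => (z i).2.1) ∧ k < ones (fun i => newBit (z i)) then (1 : ℝ) else 0 := by
    ext z
    simp only [← not_le]
    split_ifs <;> simp_all
  rw [this, wsum_add, wsum_sub, wsum_add, h0, h1, h2, jointTail]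
  ring

/-- Exponential Markov inequality for the number of ones before and after noise: half the
sum of the two centred `±1` bits has moment generating function `(1 - ε/2) cosh s + ε/2`. -/
lemma jointTail_le {ε s : ℝ} (h0 : 0 ≤ ε) (h1 : ε ≤ 1) (hs : 0 ≤ s) (l k : ℕ) :
    jointTail ε l k ≤ Real.exp (-(s * (2 * k - l))) * ((1 - ε / 2) * Real.cosh s + ε / 2) ^ l := by
  let u : Bool × Bool × Bool → ℝ := fun a => Real.exp (s * (bitVal a.2.1 + bitVal (newBit a) - 1))
  have hsum : ∑ a, noiseWeight ε a * u a = (1 - ε / 2) * Real.cosh s + ε / 2 := by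
    simp [u, noiseWeight, Fintype.sum_prod_type, newBit, bitVal, Real.cosh_eq]
    ring
  have hP := wsum_prod (ι := Fin l) (noiseWeight ε) u
  rw [hsum, Fintype.card_fin] at hP
  rw [← hP, ← wsum_const_mul]
  refine wsum_mono (noiseWeight_nonneg h0 h1) fun z => ?_
  simp only [u]
  rw [← Real.exp_sum, ← Real.exp_add]
  split_ifs with h
  · refine Real.one_le_exp ?_
    have hb : ∀ y : Fin l → Bool, ∑ i, bitVal (y i) = ones y := by
      intro y; simp [bitVal, ones]
    rw [← Finset.mul_sum, Finset.sum_sub_distrib, Finset.sum_add_distrib,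
      hb fun i => (z i).2.1, hb fun i => newBit (z i)]
    have ha : (k : ℝ) ≤ ones (fun i => (z i).2.1) := by exact_mod_cast h.1.le
    have hc : (k : ℝ) ≤ ones (fun i => newBit (z i)) := by exact_mod_cast h.2.le
    simp only [Finset.sum_const, Finset.card_univ, Fintype.card_fin, nsmul_eq_mul, mul_one]
    nlinarith
  · positivity

/-- The noise covariance reduces to the joint law of a single tribe. -/
lemma noise_covariance (hf : ∀ ω, f ω = false ↔ ∀ j, ones (block e ω j) ≤ k) (ε : ℝ) :
    noiseExpect ε (fun ω η : Cube n => bitVal (f ω) * bitVal (f η))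
        - expect (fun ω => bitVal (f ω)) ^ 2 =
      (1 - 2 * binTail l (k + 1) + jointTail ε l k) ^ m - ((1 - binTail l (k + 1)) ^ 2) ^ m := by
  classical
  let v : Cube n → ℝ := fun ω => if ∀ j, ones (block e ω j) ≤ k then 1 else 0
  have hv : ∀ ω, bitVal (f ω) = 1 - v ω := by
    intro ω
    simp only [v, ← hf ω]
    cases f ω <;> simp [bitVal]
  have h0 := wsum_one (ι := Fin n) (sum_noiseWeight ε)
  have h0' := wsum_one (ι := Fin n) sum_fairWeight
  have hF : wsum fairWeight v = (1 - binTail l (k + 1)) ^ m := by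
    rw [← prob_forall_block_le e, prob_eq_wsum]
  have hJ : wsum (noiseWeight ε) (fun z : Fin n → Bool × Bool × Bool =>
      v (fun i => (z i).2.1) * v fun i => newBit (z i)) =
      (1 - 2 * binTail l (k + 1) + jointTail ε l k) ^ m := by
    simp only [v, ite_forall_eq_prod, ← Finset.prod_mul_distrib]
    have := wsum_block e (sum_noiseWeight ε) fun _ (z : Fin l → Bool × Bool × Bool) =>
      (if ones (fun i => (z i).2.1) ≤ k then (1 : ℝ) else 0) *
        if ones (fun i => newBit (z i)) ≤ k then (1 : ℝ) else 0
    rw [Finset.prod_const, wsum_noise_le, Finset.card_univ, Fintype.card_fin] at this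
    exact this
  rw [noiseExpect_eq_wsum, expect_eq_wsum]
  simp only [hv]
  have : (fun z : Fin n → Bool × Bool × Bool =>
      (1 - v fun i => (z i).2.1) * (1 - v fun i => newBit (z i))) = fun z =>
      ((1 - v fun i => (z i).2.1) - v fun i => newBit (z i)) +
        v (fun i => (z i).2.1) * v fun i => newBit (z i) := by
    ext z; ring
  rw [this, wsum_add, wsum_sub, wsum_sub, wsum_sub, hJ, h0, h0', wsum_noise_old, wsum_noise_new, hF,
    ← pow_mul, mul_comm 2 m, pow_mul]
  ring

end Tribes

/-! ### The tribes of the theorem -/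

section MaxTribe

variable {lam : ℝ} {n : ℕ}

lemma tribeCount_mul_add (lam : ℝ) (n : ℕ) :
    tribeCount lam n * tribeSize lam n + n % tribeSize lam n = n :=
  Nat.div_add_mod' n (tribeSize lam n)

/-- The arrangement of the coordinates into tribes and a remainder. -/
noncomputable def tribeEquiv (lam : ℝ) (n : ℕ) :
    (Fin (tribeCount lam n) × Fin (tribeSize lam n)) ⊕ Fin (n % tribeSize lam n) ≃ Fin n :=
  ((Equiv.sumCongr finProdFinEquiv (Equiv.refl _)).trans finSumFinEquiv).trans
    (finCongr (tribeCount_mul_add lam n))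

lemma tribeEquiv_inl (lam : ℝ) (n : ℕ) (j : Fin (tribeCount lam n)) (i : Fin (tribeSize lam n)) :
    (tribeEquiv lam n (.inl (j, i)) : ℕ) = i + tribeSize lam n * j := by
  simp [tribeEquiv]

lemma blockSum_eq_ones (ω : Cube n) (j : Fin (tribeCount lam n)) :
    blockSum (tribeSize lam n) ω j = ones (block (tribeEquiv lam n) ω j) := by
  symm
  unfold blockSum ones
  refine Finset.card_nbij (fun i => tribeEquiv lam n (.inl (j, i))) (fun i hi => ?_)
    (fun a _ b _ hab => by simpa using hab) (fun i hi => ?_)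
  · have hi' : ω (tribeEquiv lam n (.inl (j, i))) = true := by
      have := (Finset.mem_filter.1 hi).2
      exact this
    have := i.isLt
    refine Finset.mem_filter.2 ⟨Finset.mem_univ _, ?_⟩
    simp only [tribeEquiv_inl, hi', and_true, add_mul, mul_comm (tribeSize lam n)]
    exact ⟨by omega, by omega⟩
  · obtain ⟨h1, h2, h3⟩ := (Finset.mem_filter.1 (Finset.mem_coe.1 hi)).2
    rw [add_mul, one_mul] at h2
    have he : tribeEquiv lam n (.inl (j, ⟨i - j * tribeSize lam n, by omega⟩)) = i := by
      ext
      rw [tribeEquiv_inl, mul_comm (tribeSize lam n)]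
      simp only
      omega
    refine ⟨⟨i - j * tribeSize lam n, by omega⟩, ?_, he⟩
    refine Finset.mem_coe.2 (Finset.mem_filter.2 ⟨Finset.mem_univ _, ?_⟩)
    rw [block, he, h3]

lemma maxTribe_le_iff (ω : Cube n) (k : ℕ) :
    maxTribe lam ω ≤ k ↔ ∀ j, ones (block (tribeEquiv lam n) ω j) ≤ k := by
  simp only [maxTribe, Finset.sup_le_iff, Finset.mem_range, ← blockSum_eq_ones]
  exact ⟨fun h j => h j j.isLt, fun h j hj => h ⟨j, hj⟩⟩

lemma prob_maxTribe_le (k : ℕ) :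
    prob {ω : Cube n | maxTribe lam ω ≤ k} =
      (1 - binTail (tribeSize lam n) (k + 1)) ^ tribeCount lam n := by
  simp only [maxTribe_le_iff]
  exact prob_forall_block_le _ k

lemma prob_maxTribe_lt (hm : tribeCount lam n ≠ 0) (k : ℕ) :
    prob {ω : Cube n | maxTribe lam ω < k} =
      (1 - binTail (tribeSize lam n) k) ^ tribeCount lam n := by
  cases k with
  | zero => simp [prob, expect, binTail_zero, hm]
  | succ k =>
    simp only [Nat.lt_succ_iff]
    exact prob_maxTribe_le k

/-- Only the integer part of a quantile matters; it pins the binomial tail of one tribe from both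
sides. -/
lemma IsQuantile.floor {β q : ℝ} (hβ0 : 0 < β) (hm : tribeCount lam n ≠ 0)
    (hq : IsQuantile (fun ω : Cube n => (maxTribe lam ω : ℝ)) β q) :
    β ≤ (1 - binTail (tribeSize lam n) (⌊q⌋₊ + 1)) ^ tribeCount lam n ∧
    (1 - binTail (tribeSize lam n) ⌊q⌋₊) ^ tribeCount lam n ≤ β ∧
    ∀ ω : Cube n, tribesFun lam q ω = false ↔ ∀ j, ones (block (tribeEquiv lam n) ω j) ≤ ⌊q⌋₊ := by
  have hq0 : 0 ≤ q := by
    by_contra hneg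
    have : {ω : Cube n | (maxTribe lam ω : ℝ) ≤ q} = ∅ := by
      ext ω
      have : (0 : ℝ) ≤ maxTribe lam ω := Nat.cast_nonneg _
      simp only [Set.mem_ofPred_eq, Set.mem_empty_iff_false, iff_false]
      linarith
    have h := hq.1
    rw [this] at h
    simp [prob, expect] at h
    linarith
  have hset : ∀ ω : Cube n, (maxTribe lam ω : ℝ) ≤ q ↔ maxTribe lam ω ≤ ⌊q⌋₊ := fun ω =>
    (Nat.le_floor_iff hq0).symm
  refine ⟨?_, ?_, fun ω => ?_⟩
  · rw [← prob_maxTribe_le]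
    simpa only [hset] using hq.1
  · rw [← prob_maxTribe_lt hm]
    refine (prob_mono fun ω hω => ?_).trans hq.2
    exact (Nat.cast_lt.2 hω).trans_le (Nat.floor_le hq0)
  · rw [← maxTribe_le_iff, ← hset]
    simp [tribesFun]

end MaxTribe

/-! ### Estimates for a single tribe -/

/-- The mass at `k` compared with the tails on either side of it, when `k` exceeds the mean by at
least one standard deviation: the constraints on a quantile determine the mass up to constants. -/
lemma binMass_bounds {l k : ℕ} {m b L d : ℝ} (hd : d = 2 * k - l) (hm : 0 < m)
    (hd0 : 0 < d) (hd2 : (l : ℝ) ≤ d ^ 2) (hdl : 8 * d ≤ l)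
    (hb : b ≤ m * binTail l k) (hL : m * binTail l (k + 1) ≤ L) :
    b * d ≤ m * l * binMass l k ∧ m * l * binMass l k ≤ 8 * d * L := by
  have hkl' : (k : ℝ) ≤ l := by linarith
  have hkl : k ≤ l := by exact_mod_cast hkl'
  have hM := binMass_nonneg l k
  have hT := binTail_nonneg l k
  have h1 := mul_binTail_le hkl
  have h2 := mul_binMass_le hkl (hd ▸ hd0) (hd ▸ hd2)
  have h3 := binTail_eq_add l k
  rw [← hd] at h1 h2
  constructor
  · have h4 : (k : ℝ) * binMass l k ≤ l * binMass l k := mul_le_mul_of_nonneg_right hkl' hM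
    nlinarith [mul_le_mul_of_nonneg_left (h1.trans h4) hm.le]
  · have h4 : (l : ℝ) * binMass l k ≤ 4 * d * binTail l k := by nlinarith
    have h5 : binMass l k ≤ binTail l k / 2 := by
      have : (l : ℝ) * binMass l k ≤ l * (binTail l k / 2) := by nlinarith
      exact le_of_mul_le_mul_left this (by linarith)
    have h6 : (l : ℝ) * binMass l k ≤ 8 * d * binTail l (k + 1) := by nlinarith
    nlinarith [mul_le_mul_of_nonneg_left h6 hm.le, mul_le_mul_of_nonneg_left hL hd0.le]

lemma mul_binMass_pred {l k : ℕ} (hl : 0 < l) (hk : k ≤ l) :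
    (l : ℝ) * binMass (l - 1) k = (l - (2 * k - l)) * binMass l k := by
  obtain ⟨l, rfl⟩ : ∃ l', l = l' + 1 := ⟨l - 1, by omega⟩
  have h := Nat.choose_mul_succ_eq l k
  have h' : (l.choose k : ℝ) * (l + 1) = (l + 1).choose k * ((l + 1 : ℕ) - k : ℝ) := by
    rw [← Nat.cast_sub hk]; exact_mod_cast h
  simp only [Nat.add_sub_cancel, binMass, pow_succ]
  push_cast at h' ⊢
  field_simp
  linear_combination 2 * h'

lemma abs_pow_sub_pow_le_mul {a b : ℝ} (ha0 : 0 ≤ a) (ha1 : a ≤ 1) (hb0 : 0 ≤ b) (hb1 : b ≤ 1)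
    (m : ℕ) : |a ^ m - b ^ m| ≤ m * |a - b| := by
  refine (abs_pow_sub_pow_le a b m).trans ?_
  rw [abs_of_nonneg ha0, abs_of_nonneg hb0, mul_comm (|a - b|)]
  exact mul_le_of_le_one_right (by positivity)
    (pow_le_one₀ (le_max_of_le_left ha0) (max_le ha1 hb1))

/-- A Gaussian bound for the probability that a tribe is large before and after noise. The noise
improves the exponent of `binTail_le_exp` by a factor larger than `1`. -/
lemma jointTail_le_exp {ε d : ℝ} {l k : ℕ} (h0 : 0 ≤ ε) (h1 : ε ≤ 1) (hd : d = 2 * k - l)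
    (hl : 0 < l) (hd0 : 0 ≤ d) (hdl : d ≤ l) :
    jointTail ε l k ≤ Real.exp (-(d ^ 2 / (2 * l) * (1 + ε / 2 - (d / l) ^ 2 / 2))) := by
  have hl' : (0 : ℝ) < l := by exact_mod_cast hl
  set s := d / l with hs
  have hs0 : 0 ≤ s := by positivity
  have hs1 : s ≤ 1 := (div_le_one hl').2 hdl
  have hds : d = s * l := by rw [hs]; field_simp
  have hcosh : Real.cosh s - 1 ≤ s ^ 2 / 2 + s ^ 4 / 4 := by
    have h2 := Real.cosh_le_exp_half_sq s
    have h3 := Real.abs_exp_sub_one_sub_id_le (x := s ^ 2 / 2) (by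
      rw [abs_of_nonneg (by positivity)]; nlinarith)
    have h4 := (abs_le.1 h3).2
    nlinarith
  have hbase : (1 - ε / 2) * Real.cosh s + ε / 2 ≤
      Real.exp ((1 - ε / 2) * (s ^ 2 / 2 + s ^ 4 / 4)) := by
    refine le_trans ?_ (Real.add_one_le_exp _)
    nlinarith [mul_le_mul_of_nonneg_left hcosh (show 0 ≤ 1 - ε / 2 by linarith)]
  have hbase0 : 0 ≤ (1 - ε / 2) * Real.cosh s + ε / 2 := by
    have := Real.cosh_pos s
    have : 0 ≤ (1 - ε / 2) * Real.cosh s := mul_nonneg (by linarith) this.le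
    linarith
  refine (jointTail_le h0 h1 hs0 l k).trans ?_
  refine (mul_le_mul_of_nonneg_left (pow_le_pow_left₀ hbase0 hbase l) (Real.exp_pos _).le).trans ?_
  rw [← Real.exp_nat_mul, ← Real.exp_add, Real.exp_le_exp, ← hd, hds]
  have h5 : (s * l) ^ 2 / (2 * l) = s ^ 2 * l / 2 := by field_simp
  rw [h5]
  have h6 : 0 ≤ ε * (l * s ^ 4) := by positivity
  nlinarith

/-! ### The size and number of tribes, and the location of quantiles -/

section Asymptotics

variable {lam : ℝ}

lemma tribeSize_bounds (h0 : 0 < lam) : ∀ᶠ n : ℕ in atTop,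
    (n : ℝ) ^ lam / 2 ≤ tribeSize lam n ∧ (tribeSize lam n : ℝ) ≤ (n : ℝ) ^ lam := by
  have h := ((tendsto_rpow_atTop h0).comp tendsto_natCast_atTop_atTop).eventually_ge_atTop 2
  filter_upwards [h] with n hn
  simp only [Function.comp] at hn
  have h1 := Nat.lt_floor_add_one ((n : ℝ) ^ lam)
  refine ⟨?_, Nat.floor_le (by positivity)⟩
  unfold tribeSize
  linarith

lemma tendsto_tribeSize (h0 : 0 < lam) :
    Tendsto (fun n : ℕ => (tribeSize lam n : ℝ)) atTop atTop := by
  have h := ((tendsto_rpow_atTop h0).comp tendsto_natCast_atTop_atTop).atTop_div_const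
    (show (0 : ℝ) < 2 by norm_num)
  exact tendsto_atTop_mono' _ ((tribeSize_bounds h0).mono fun n hn => hn.1) h

lemma tribeSize_le (h1 : lam ≤ 1) {n : ℕ} (hn : 1 ≤ n) : tribeSize lam n ≤ n := by
  have hn' : (1 : ℝ) ≤ n := by exact_mod_cast hn
  refine Nat.floor_le_of_le ?_
  calc (n : ℝ) ^ lam ≤ (n : ℝ) ^ (1 : ℝ) := Real.rpow_le_rpow_of_exponent_le hn' h1
    _ = n := Real.rpow_one _

lemma tribeSize_pos (h0 : 0 ≤ lam) {n : ℕ} (hn : 1 ≤ n) : 0 < tribeSize lam n := by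
  have hn' : (1 : ℝ) ≤ n := by exact_mod_cast hn
  exact Nat.floor_pos.2 (Real.one_le_rpow hn' h0)

lemma tribeCount_pos (h0 : 0 ≤ lam) (h1 : lam ≤ 1) {n : ℕ} (hn : 1 ≤ n) :
    0 < tribeCount lam n :=
  Nat.div_pos (tribeSize_le h1 hn) (tribeSize_pos h0 hn)

lemma tribeCount_mul_le (lam : ℝ) (n : ℕ) : (tribeCount lam n * tribeSize lam n : ℝ) ≤ n := by
  exact_mod_cast Nat.div_mul_le_self n (tribeSize lam n)

lemma le_two_mul_tribeCount_mul (h0 : 0 ≤ lam) (h1 : lam ≤ 1) {n : ℕ} (hn : 1 ≤ n) :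
    (n : ℝ) ≤ 2 * (tribeCount lam n * tribeSize lam n) := by
  have h2 := tribeCount_mul_add lam n
  have h3 := Nat.mod_lt n (tribeSize_pos h0 hn)
  have h4 := Nat.le_mul_of_pos_left (tribeSize lam n) (tribeCount_pos h0 h1 hn)
  have : n ≤ 2 * (tribeCount lam n * tribeSize lam n) := by omega
  exact_mod_cast this

/-- The number of tribes is of order at least `n^(1 - lam)`. -/
lemma rpow_le_tribeCount (h0 : 0 ≤ lam) (h1 : lam ≤ 1) {n : ℕ} (hn : 1 ≤ n) :
    (n : ℝ) ^ (1 - lam) ≤ 2 * tribeCount lam n := by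
  have hn' : (0 : ℝ) < n := by exact_mod_cast hn
  have h2 := le_two_mul_tribeCount_mul h0 h1 hn
  have h3 : (tribeSize lam n : ℝ) ≤ (n : ℝ) ^ lam := Nat.floor_le (by positivity)
  rw [Real.rpow_sub hn', Real.rpow_one, div_le_iff₀ (by positivity)]
  have : (tribeCount lam n : ℝ) * tribeSize lam n ≤ tribeCount lam n * (n : ℝ) ^ lam := by gcongr
  linarith

lemma tendsto_tribeCount (h0 : 0 ≤ lam) (h1 : lam < 1) :
    Tendsto (fun n : ℕ => (tribeCount lam n : ℝ)) atTop atTop := by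
  have h := ((tendsto_rpow_atTop (sub_pos.2 h1)).comp tendsto_natCast_atTop_atTop).atTop_div_const
    (show (0 : ℝ) < 2 by norm_num)
  refine tendsto_atTop_mono' _ ?_ h
  filter_upwards [eventually_ge_atTop 1] with n hn
  have := rpow_le_tribeCount h0 h1.le hn
  simp only [Function.comp]
  linarith

lemma tendsto_log_natCast : Tendsto (fun n : ℕ => Real.log n) atTop atTop :=
  Real.tendsto_log_atTop.comp tendsto_natCast_atTop_atTop

lemma tendsto_log_div_tribeSize (h0 : 0 < lam) :
    Tendsto (fun n : ℕ => Real.log n / tribeSize lam n) atTop (𝓝 0) := by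
  have h := ((isLittleO_log_rpow_atTop h0).tendsto_div_nhds_zero.comp
    tendsto_natCast_atTop_atTop).const_mul 2
  rw [mul_zero] at h
  refine squeeze_zero' ?_ ?_ h
  · filter_upwards [tendsto_log_natCast.eventually_ge_atTop 0] with n hn
    positivity
  · filter_upwards [tendsto_log_natCast.eventually_ge_atTop 0, tribeSize_bounds h0,
      eventually_ge_atTop 1] with n hn hb h1
    have hn' : (0 : ℝ) < n := by exact_mod_cast h1
    have hp : 0 < (n : ℝ) ^ lam := by positivity
    simp only [Function.comp]
    calc Real.log n / tribeSize lam n ≤ Real.log n / ((n : ℝ) ^ lam / 2) := by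
          gcongr; exact hb.1
      _ = _ := by ring

variable {b L : ℝ} {k : ℕ → ℕ}

/-- There are at most `n` tribes, so by Hoeffding's inequality twice a quantile exceeds the tribe
size `l` by at most `2 √(l log n)`. -/
lemma excess_le (h0 : 0 < lam) (hb0 : 0 < b)
    (hb : ∀ᶠ n in atTop, b ≤ tribeCount lam n * binTail (tribeSize lam n) (k n)) :
    ∀ᶠ n : ℕ in atTop,
      (2 * k n - tribeSize lam n : ℝ) ≤ 2 * √(tribeSize lam n * Real.log n) := by
  filter_upwards [hb, eventually_ge_atTop 1,
    tendsto_natCast_atTop_atTop.eventually_gt_atTop (1 / b)] with n hb hn hnb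
  by_contra! hlt
  set l := tribeSize lam n
  set m := tribeCount lam n
  have hl : 0 < l := tribeSize_pos h0.le hn
  have hl' : (0 : ℝ) < l := by exact_mod_cast hl
  have hn' : (1 : ℝ) ≤ n := by exact_mod_cast hn
  have hlog : 0 ≤ Real.log n := Real.log_nonneg hn'
  have hT := binTail_le_exp hl (le_trans (by positivity) hlt.le)
  have hsq : 4 * (l * Real.log n) ≤ (2 * k n - l : ℝ) ^ 2 := by
    have := pow_le_pow_left₀ (by positivity) hlt.le 2
    rwa [mul_pow, Real.sq_sqrt (by positivity), show (2 : ℝ) ^ 2 = 4 by norm_num] at this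
  have hexp : Real.exp (-(2 * k n - l : ℝ) ^ 2 / (2 * l)) ≤ ((n : ℝ) ^ 2)⁻¹ := by
    rw [← Real.exp_log (show (0 : ℝ) < (n : ℝ) ^ 2 by positivity), ← Real.exp_neg,
      Real.exp_le_exp, Real.log_pow, div_le_iff₀ (by positivity)]
    push_cast
    linarith
  have hm : (m : ℝ) ≤ n := by exact_mod_cast Nat.div_le_self _ _
  have : b ≤ n * ((n : ℝ) ^ 2)⁻¹ :=
    hb.trans (mul_le_mul hm (hT.trans hexp) (binTail_nonneg _ _) (by positivity))
  have h2 : n * ((n : ℝ) ^ 2)⁻¹ = 1 / n := by field_simp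
  rw [h2, le_div_iff₀ (by positivity)] at this
  rw [div_lt_iff₀ hb0] at hnb
  linarith

/-- There are at least of the order of `n^(1 - lam)` tribes, so by the lower bound for binomial tails
quantiles exceed the mean by at least the order of `√(l log n)`. -/
lemma le_excess (h0 : 0 < lam) (h1 : lam < 1)
    (hL : ∀ᶠ n in atTop, tribeCount lam n * binTail (tribeSize lam n) (k n + 1) ≤ L) :
    ∀ᶠ n : ℕ in atTop, √((1 - lam) / 8) * √(tribeSize lam n * Real.log n) ≤
      2 * k n - tribeSize lam n := by
  set A := √((1 - lam) / 8) with hA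
  have hA0 : 0 < A := Real.sqrt_pos.2 (by linarith)
  have hA2 : A ^ 2 = (1 - lam) / 8 := Real.sq_sqrt (by linarith)
  have hA1 : A ≤ 1 := by nlinarith
  have hpow := ((tendsto_rpow_atTop (show 0 < (1 - lam) / 2 by linarith)).comp
    tendsto_natCast_atTop_atTop).eventually_gt_atTop (8 * L)
  filter_upwards [hL, eventually_ge_atTop 1, hpow, (tendsto_tribeSize h0).eventually_ge_atTop 8,
    (tendsto_log_div_tribeSize h0).eventually_le_const (show (0 : ℝ) < 1 / 256 by norm_num),
    tendsto_log_natCast.eventually_ge_atTop ((4 / A) ^ 2)] with n hL hn hpow hl8 hsmall hlog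
  by_contra! hlt
  set l := tribeSize lam n
  set m := tribeCount lam n
  have hl : 0 < l := tribeSize_pos h0.le hn
  have hl' : (0 : ℝ) < l := by exact_mod_cast hl
  have hn' : (1 : ℝ) ≤ n := by exact_mod_cast hn
  have hlog0 : 0 ≤ Real.log n := Real.log_nonneg hn'
  rw [div_le_iff₀ hl'] at hsmall
  have hs1 : 1 ≤ √(l : ℝ) := Real.one_le_sqrt.2 (by linarith)
  have hs2 : 4 ≤ A * √(Real.log n) := by
    have := Real.le_sqrt_of_sq_le hlog
    rwa [div_le_iff₀ hA0, mul_comm] at this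
  have hK : (2 * (k n + 1 : ℕ) - l : ℝ) + 2 * √l ≤ 2 * A * √(l * Real.log n) := by
    rw [Real.sqrt_mul hl'.le] at hlt ⊢
    push_cast
    nlinarith [mul_le_mul_of_nonneg_left hs2 (Real.sqrt_nonneg (l : ℝ))]
  have hD : 2 * (2 * A * √(l * Real.log n)) + 2 ≤ 1 / (1 + 1) * l := by
    have : √(l * Real.log n) ≤ l / 16 := by
      refine Real.sqrt_le_iff.2 ⟨by positivity, ?_⟩
      nlinarith
    nlinarith [Real.sqrt_nonneg (l * Real.log n)]
  have hT := exp_le_binTail one_pos hl hK hD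
  have he : Real.exp (-((1 + 1) * (2 * A * √(l * Real.log n)) ^ 2 / (2 * l))) =
      ((n : ℝ) ^ ((1 - lam) / 2))⁻¹ := by
    rw [← Real.rpow_neg (by positivity), Real.rpow_def_of_pos (by positivity), mul_pow, mul_pow,
      hA2, Real.sq_sqrt (mul_nonneg hl'.le hlog0)]
    congr 1
    field_simp
    ring
  rw [he] at hT
  have hm := rpow_le_tribeCount h0.le h1.le hn
  have hp : 0 < (n : ℝ) ^ ((1 - lam) / 2) := by positivity
  have hpp : (n : ℝ) ^ (1 - lam) = (n : ℝ) ^ ((1 - lam) / 2) * (n : ℝ) ^ ((1 - lam) / 2) := by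
    rw [← Real.rpow_add (by positivity)]; ring_nf
  rw [hpp] at hm
  have h3 : (n : ℝ) ^ ((1 - lam) / 2) * (n : ℝ) ^ ((1 - lam) / 2) *
      (1 / 4 * ((n : ℝ) ^ ((1 - lam) / 2))⁻¹) ≤ 2 * m * binTail l (k n + 1) :=
    mul_le_mul hm hT (by positivity) (by positivity)
  have h4 : (n : ℝ) ^ ((1 - lam) / 2) * (n : ℝ) ^ ((1 - lam) / 2) *
      (1 / 4 * ((n : ℝ) ^ ((1 - lam) / 2))⁻¹) = (n : ℝ) ^ ((1 - lam) / 2) / 4 := by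
    field_simp
  rw [h4] at h3
  simp only [Function.comp] at hpow
  linarith

end Asymptotics

/-! ### Asymptotics at the quantile -/

section Quantile

variable {lam b L : ℝ} {k : ℕ → ℕ}

/-- The order of magnitude of the excess of a quantile over the mean. -/
lemma excess_bounds (h0 : 0 < lam) (h1 : lam < 1) (hb0 : 0 < b)
    (hb : ∀ᶠ n in atTop, b ≤ tribeCount lam n * binTail (tribeSize lam n) (k n))
    (hL : ∀ᶠ n in atTop, tribeCount lam n * binTail (tribeSize lam n) (k n + 1) ≤ L) :
    ∀ᶠ n : ℕ in atTop, 0 < (2 * k n - tribeSize lam n : ℝ) ∧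
      (1 - lam) / 8 * (tribeSize lam n * Real.log n) ≤ (2 * k n - tribeSize lam n : ℝ) ^ 2 ∧
      (2 * k n - tribeSize lam n : ℝ) ^ 2 ≤ 4 * (tribeSize lam n * Real.log n) := by
  filter_upwards [excess_le h0 hb0 hb, le_excess h0 h1 hL, eventually_ge_atTop 1,
    tendsto_log_natCast.eventually_gt_atTop 0] with n hle hge hn hlog
  have hl : (0 : ℝ) < tribeSize lam n := by exact_mod_cast tribeSize_pos h0.le hn
  have hpos : 0 < √((1 - lam) / 8) * √(tribeSize lam n * Real.log n) :=
    mul_pos (Real.sqrt_pos.2 (by linarith)) (Real.sqrt_pos.2 (by positivity))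
  have h2 := pow_le_pow_left₀ hpos.le hge 2
  have h3 := pow_le_pow_left₀ (hpos.le.trans hge) hle 2
  rw [mul_pow, Real.sq_sqrt (by linarith), Real.sq_sqrt (by positivity)] at h2
  rw [mul_pow, Real.sq_sqrt (by positivity)] at h3
  exact ⟨hpos.trans_le hge, h2, by linarith⟩

lemma tendsto_excess_div (h0 : 0 < lam) (h1 : lam < 1) (hb0 : 0 < b)
    (hb : ∀ᶠ n in atTop, b ≤ tribeCount lam n * binTail (tribeSize lam n) (k n))
    (hL : ∀ᶠ n in atTop, tribeCount lam n * binTail (tribeSize lam n) (k n + 1) ≤ L) :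
    Tendsto (fun n => (2 * k n - tribeSize lam n : ℝ) / tribeSize lam n) atTop (𝓝 0) := by
  have h := ((tendsto_log_div_tribeSize h0).const_mul 4).sqrt
  rw [mul_zero, Real.sqrt_zero] at h
  refine squeeze_zero' ?_ ?_ h
  · filter_upwards [excess_bounds h0 h1 hb0 hb hL] with n hn
    have := hn.1.le
    positivity
  · filter_upwards [excess_bounds h0 h1 hb0 hb hL, eventually_ge_atTop 1] with n hn h1
    have hl : (0 : ℝ) < tribeSize lam n := by exact_mod_cast tribeSize_pos h0.le h1
    refine Real.le_sqrt_of_sq_le ?_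
    rw [div_pow, div_le_iff₀ (by positivity)]
    refine hn.2.2.trans_eq ?_
    field_simp

lemma tendsto_excess_sq_div (h0 : 0 < lam) (h1 : lam < 1) (hb0 : 0 < b)
    (hb : ∀ᶠ n in atTop, b ≤ tribeCount lam n * binTail (tribeSize lam n) (k n))
    (hL : ∀ᶠ n in atTop, tribeCount lam n * binTail (tribeSize lam n) (k n + 1) ≤ L) :
    Tendsto (fun n => (2 * k n - tribeSize lam n : ℝ) ^ 2 / tribeSize lam n) atTop atTop := by
  refine tendsto_atTop_mono' _ ?_
    (tendsto_log_natCast.const_mul_atTop (show 0 < (1 - lam) / 8 by linarith))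
  filter_upwards [excess_bounds h0 h1 hb0 hb hL, eventually_ge_atTop 1] with n hn h1
  have hl : (0 : ℝ) < tribeSize lam n := by exact_mod_cast tribeSize_pos h0.le h1
  rw [le_div_iff₀ hl]
  linarith [hn.2.1]

lemma binMass_bounds_eventually (h0 : 0 < lam) (h1 : lam < 1) (hb0 : 0 < b)
    (hb : ∀ᶠ n in atTop, b ≤ tribeCount lam n * binTail (tribeSize lam n) (k n))
    (hL : ∀ᶠ n in atTop, tribeCount lam n * binTail (tribeSize lam n) (k n + 1) ≤ L) :
    ∀ᶠ n : ℕ in atTop,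
      b * (2 * k n - tribeSize lam n) ≤
        tribeCount lam n * tribeSize lam n * binMass (tribeSize lam n) (k n) ∧
      tribeCount lam n * tribeSize lam n * binMass (tribeSize lam n) (k n) ≤
        8 * (2 * k n - tribeSize lam n) * L := by
  filter_upwards [hb, hL, excess_bounds h0 h1 hb0 hb hL, eventually_ge_atTop 1,
    (tendsto_excess_div h0 h1 hb0 hb hL).eventually_le_const (show (0 : ℝ) < 1 / 8 by norm_num),
    (tendsto_excess_sq_div h0 h1 hb0 hb hL).eventually_ge_atTop 1] with n hb hL hd hn h8 hsq
  have hl : (0 : ℝ) < tribeSize lam n := by exact_mod_cast tribeSize_pos h0.le hn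
  rw [div_le_iff₀ hl] at h8
  rw [le_div_iff₀ hl] at hsq
  exact binMass_bounds rfl (by exact_mod_cast tribeCount_pos h0.le h1.le hn) hd.1
    (by linarith) (by linarith) hb hL

/-- The expected number of tribes with exactly `k n` ones tends to `0`. -/
lemma tendsto_tribeCount_mul_binMass (h0 : 0 < lam) (h1 : lam < 1) (hb0 : 0 < b)
    (hb : ∀ᶠ n in atTop, b ≤ tribeCount lam n * binTail (tribeSize lam n) (k n))
    (hL : ∀ᶠ n in atTop, tribeCount lam n * binTail (tribeSize lam n) (k n + 1) ≤ L) :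
    Tendsto (fun n => tribeCount lam n * binMass (tribeSize lam n) (k n)) atTop (𝓝 0) := by
  have h := (tendsto_excess_div h0 h1 hb0 hb hL).const_mul (8 * L)
  rw [mul_zero] at h
  refine squeeze_zero' (.of_forall fun n => mul_nonneg (Nat.cast_nonneg _) (binMass_nonneg _ _))
    ?_ h
  filter_upwards [binMass_bounds_eventually h0 h1 hb0 hb hL, eventually_ge_atTop 1] with n hM hn
  have hl : (0 : ℝ) < tribeSize lam n := by exact_mod_cast tribeSize_pos h0.le hn
  rw [← mul_div_assoc, le_div_iff₀ hl]
  linarith [hM.2]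

/-- The expected number of tribes that exceed the quantile both before and after noise tends to
`0`: noise improves the Gaussian exponent by a constant factor, while `exp_le_binTail` loses only a
factor arbitrarily close to `1`. -/
lemma tendsto_tribeCount_mul_jointTail {ε : ℝ} (hε0 : 0 < ε) (hε1 : ε < 1)
    (h0 : 0 < lam) (h1 : lam < 1) (hb0 : 0 < b)
    (hb : ∀ᶠ n in atTop, b ≤ tribeCount lam n * binTail (tribeSize lam n) (k n))
    (hL : ∀ᶠ n in atTop, tribeCount lam n * binTail (tribeSize lam n) (k n + 1) ≤ L) :
    Tendsto (fun n => tribeCount lam n * jointTail ε (tribeSize lam n) (k n)) atTop (𝓝 0) := by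
  have hlim : Tendsto (fun n => 4 * L * Real.exp
      (-(ε / 16 * ((2 * k n - tribeSize lam n : ℝ) ^ 2 / tribeSize lam n)))) atTop (𝓝 0) := by
    have := (Real.tendsto_exp_neg_atTop_nhds_zero.comp
      ((tendsto_excess_sq_div h0 h1 hb0 hb hL).const_mul_atTop
        (show 0 < ε / 16 by positivity))).const_mul (4 * L)
    rwa [mul_zero] at this
  -- `(1 + δ) ^ 3 ≤ 1 + ε / 4`: a factor `1 + δ` is lost in the tail bound, two in its argument
  set δ := ε / 28 with hδ
  have hδ0 : 0 < δ := by positivity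
  have hδ3 : (1 + δ) ^ 3 ≤ 1 + ε / 4 := by
    have : δ ≤ 1 := by linarith
    have : (1 + δ) ^ 3 ≤ 1 + 7 * δ := by nlinarith [mul_nonneg hδ0.le hδ0.le]
    linarith
  have hη : 0 < min (ε / 2) (min 1 (δ / (1 + δ) / 8)) := by positivity
  refine squeeze_zero' (.of_forall fun n => mul_nonneg (Nat.cast_nonneg _)
    (wsum_nonneg (noiseWeight_nonneg hε0.le hε1.le) fun z => by positivity)) ?_ hlim
  filter_upwards [hL, excess_bounds h0 h1 hb0 hb hL, eventually_ge_atTop 1,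
    (tendsto_excess_div h0 h1 hb0 hb hL).eventually_le_const hη,
    (tendsto_excess_sq_div h0 h1 hb0 hb hL).eventually_ge_atTop ((4 / δ) ^ 2),
    (tendsto_tribeSize h0).eventually_ge_atTop (max 1 (4 * ((1 + δ) / δ)))]
    with n hL hd hn hsmall hsq hlbig
  set l := tribeSize lam n
  set m := tribeCount lam n
  set d : ℝ := 2 * k n - l with hdef
  have hl : 0 < l := tribeSize_pos h0.le hn
  have hl' : (0 : ℝ) < l := by exact_mod_cast hl
  obtain ⟨hs1, hs2, hs3⟩ : d / l ≤ ε / 2 ∧ d / l ≤ 1 ∧ d / l ≤ δ / (1 + δ) / 8 := by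
    simpa only [le_min_iff] using hsmall
  obtain ⟨hl1, hl2⟩ := max_le_iff.1 hlbig
  have hd0 := hd.1
  have hs0 : 0 ≤ d / l := by positivity
  have hsqrt : 4 * √(l : ℝ) ≤ δ * d := by
    have h2 : (4 / δ) ^ 2 * l ≤ d ^ 2 := (le_div_iff₀ hl').1 hsq
    have h3 : 4 / δ * √(l : ℝ) ≤ d := by
      refine le_of_sq_le_sq ?_ hd0.le
      rwa [mul_pow, Real.sq_sqrt hl'.le]
    rwa [div_mul_eq_mul_div, div_le_iff₀ hδ0, mul_comm d] at h3
  have hsqrt1 : 1 ≤ √(l : ℝ) := Real.one_le_sqrt.2 hl1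
  have hK : (2 * (k n + 1 : ℕ) - l : ℝ) + 2 * √l ≤ (1 + δ) * d := by
    push_cast
    linarith
  have hD : 2 * ((1 + δ) * d) + 2 ≤ δ / (1 + δ) * l := by
    rw [div_le_iff₀ hl'] at hs3
    have h3 : 4 ≤ δ / (1 + δ) * l := by
      have : 4 * ((1 + δ) / δ) * (δ / (1 + δ)) = 4 := by field_simp
      rw [← this, mul_comm (δ / (1 + δ))]
      exact mul_le_mul_of_nonneg_right hl2 (by positivity)
    have h4 : δ * d ≤ d := mul_le_of_le_one_left hd0.le (by linarith)
    linarith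
  have hT := exp_le_binTail hδ0 hl hK hD
  have hJ := jointTail_le_exp (k := k n) hε0.le hε1.le hdef hl hd0.le ((div_le_one hl').1 hs2)
  have hT0 : 0 < binTail l (k n + 1) := lt_of_lt_of_le (by positivity) hT
  have hLpos : 0 ≤ L := le_trans (by positivity) hL
  -- the comparison of the two exponents
  have hcmp : jointTail ε l (k n) ≤ 4 * Real.exp (-(ε / 16 * (d ^ 2 / l))) *
      binTail l (k n + 1) := by
    refine hJ.trans (le_trans ?_ (mul_le_mul_of_nonneg_left hT (by positivity)))
    rw [show ∀ x y : ℝ, 4 * x * (1 / 4 * y) = x * y from fun x y => by ring, ← Real.exp_add,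
      Real.exp_le_exp]
    have h5 : (1 + δ) * ((1 + δ) * d) ^ 2 / (2 * l) = d ^ 2 / (2 * l) * (1 + δ) ^ 3 := by ring
    have h6 : ε / 16 * (d ^ 2 / l) = d ^ 2 / (2 * l) * (ε / 8) := by field_simp; ring
    rw [h5, h6]
    have h7 : (d / l) ^ 2 / 2 ≤ ε / 8 := by nlinarith
    have h8 : d ^ 2 / (2 * l) * (ε / 8 + (1 + δ) ^ 3) ≤
        d ^ 2 / (2 * l) * (1 + ε / 2 - (d / l) ^ 2 / 2) :=
      mul_le_mul_of_nonneg_left (by linarith) (by positivity)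
    linarith
  calc (m : ℝ) * jointTail ε l (k n)
      ≤ m * (4 * Real.exp (-(ε / 16 * (d ^ 2 / l))) * binTail l (k n + 1)) :=
        mul_le_mul_of_nonneg_left hcmp (Nat.cast_nonneg _)
    _ = 4 * Real.exp (-(ε / 16 * (d ^ 2 / l))) * (m * binTail l (k n + 1)) := by ring
    _ ≤ 4 * Real.exp (-(ε / 16 * (d ^ 2 / l))) * L :=
        mul_le_mul_of_nonneg_left hL (by positivity)
    _ = _ := by ring

/-- The noise covariance is at most the number of tribes times the covariance of one tribe. -/
lemma tendsto_noise_covariance {ε : ℝ} (hε0 : 0 < ε) (hε1 : ε < 1)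
    (h0 : 0 < lam) (h1 : lam < 1) (hb0 : 0 < b)
    (hb : ∀ᶠ n in atTop, b ≤ tribeCount lam n * binTail (tribeSize lam n) (k n))
    (hL : ∀ᶠ n in atTop, tribeCount lam n * binTail (tribeSize lam n) (k n + 1) ≤ L) :
    Tendsto (fun n => (1 - 2 * binTail (tribeSize lam n) (k n + 1) +
        jointTail ε (tribeSize lam n) (k n)) ^ tribeCount lam n -
      ((1 - binTail (tribeSize lam n) (k n + 1)) ^ 2) ^ tribeCount lam n) atTop (𝓝 0) := by
  have hlim := (tendsto_tribeCount_mul_jointTail hε0 hε1 h0 h1 hb0 hb hL).add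
    ((tendsto_const_nhds (x := L ^ 2)).div_atTop (tendsto_tribeCount h0.le h1))
  rw [add_zero] at hlim
  refine squeeze_zero_norm' ?_ hlim
  filter_upwards [hL, eventually_ge_atTop 1] with n hL hn
  set l := tribeSize lam n
  set m := tribeCount lam n
  have hm : (0 : ℝ) < m := by exact_mod_cast tribeCount_pos h0.le h1.le hn
  have hw := noiseWeight_nonneg hε0.le hε1.le
  have hJ := wsum_noise_le ε l (k n)
  have hJ0 : 0 ≤ 1 - 2 * binTail l (k n + 1) + jointTail ε l (k n) := by
    rw [← hJ]
    exact wsum_nonneg hw fun z => by positivity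
  have hJ1 : 1 - 2 * binTail l (k n + 1) + jointTail ε l (k n) ≤ 1 := by
    rw [← hJ]
    refine (wsum_mono hw fun z => ?_).trans_eq (wsum_one (sum_noiseWeight ε))
    split_ifs <;> simp
  have ht0 := binTail_nonneg l (k n + 1)
  have ht1 := binTail_le_one l (k n + 1)
  have hB : 0 ≤ jointTail ε l (k n) := wsum_nonneg hw fun z => by positivity
  rw [Real.norm_eq_abs]
  refine (abs_pow_sub_pow_le_mul hJ0 hJ1 (sq_nonneg _)
    (pow_le_one₀ (by linarith) (by linarith)) m).trans ?_
  have h2 : |1 - 2 * binTail l (k n + 1) + jointTail ε l (k n) - (1 - binTail l (k n + 1)) ^ 2| ≤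
      jointTail ε l (k n) + binTail l (k n + 1) ^ 2 := by
    rw [abs_le]
    constructor <;> nlinarith
  refine (mul_le_mul_of_nonneg_left h2 hm.le).trans ?_
  rw [mul_add]
  refine add_le_add le_rfl ?_
  rw [le_div_iff₀ hm]
  have h3 : (m * binTail l (k n + 1)) ^ 2 ≤ L ^ 2 := pow_le_pow_left₀ (by positivity) hL 2
  linarith

/-- The order of the sum of the squared influences. -/
lemma influence_sum_bounds {β : ℝ} (hβ : 0 < β) (h0 : 0 < lam) (h1 : lam < 1) (hb0 : 0 < b)
    (hb : ∀ᶠ n in atTop, b ≤ tribeCount lam n * binTail (tribeSize lam n) (k n))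
    (hL : ∀ᶠ n in atTop, tribeCount lam n * binTail (tribeSize lam n) (k n + 1) ≤ L)
    (hq : ∀ᶠ n in atTop, β ≤ (1 - binTail (tribeSize lam n) (k n + 1)) ^ tribeCount lam n) :
    ∀ᶠ n : ℕ in atTop,
      b ^ 2 * β ^ 2 * (1 - lam) / 64 * (Real.log n / (n : ℝ) ^ (1 - lam)) ≤
        (tribeCount lam n * tribeSize lam n : ℝ) *
          ((1 - binTail (tribeSize lam n) (k n + 1)) ^ (tribeCount lam n - 1) *
            binMass (tribeSize lam n - 1) (k n)) ^ 2 ∧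
      (tribeCount lam n * tribeSize lam n : ℝ) *
          ((1 - binTail (tribeSize lam n) (k n + 1)) ^ (tribeCount lam n - 1) *
            binMass (tribeSize lam n - 1) (k n)) ^ 2 ≤
        512 * L ^ 2 * (Real.log n / (n : ℝ) ^ (1 - lam)) := by
  filter_upwards [hq, excess_bounds h0 h1 hb0 hb hL, eventually_ge_atTop 1,
    (tendsto_excess_div h0 h1 hb0 hb hL).eventually_le_const (show (0 : ℝ) < 1 / 2 by norm_num),
    binMass_bounds_eventually h0 h1 hb0 hb hL, tribeSize_bounds h0,
    tendsto_log_natCast.eventually_ge_atTop 0] with n hq hd hn hsmall hM hlb hlog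
  have hml := tribeCount_mul_le lam n
  have hml' := le_two_mul_tribeCount_mul h0.le h1.le hn
  set l := tribeSize lam n
  set m := tribeCount lam n
  set d : ℝ := 2 * k n - l with hdef
  have hn' : (0 : ℝ) < n := by exact_mod_cast hn
  have hl : 0 < l := tribeSize_pos h0.le hn
  have hl' : (0 : ℝ) < l := by exact_mod_cast hl
  have hm : 0 < m := tribeCount_pos h0.le h1.le hn
  have hm' : (0 : ℝ) < m := by exact_mod_cast hm
  rw [div_le_iff₀ hl'] at hsmall
  have hd0 := hd.1
  have hkl : (k n : ℝ) ≤ l := by linarith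
  have hpred := mul_binMass_pred hl (by exact_mod_cast hkl : k n ≤ l)
  rw [← hdef] at hpred
  have hM0 := binMass_nonneg l (k n)
  have hP0 := binMass_nonneg (l - 1) (k n)
  have ht0 := binTail_nonneg l (k n + 1)
  have ht1 := binTail_le_one l (k n + 1)
  set F := (1 - binTail l (k n + 1)) ^ (m - 1) with hF
  have hF1 : F ≤ 1 := pow_le_one₀ (by linarith) (by linarith)
  have hFβ : β ≤ F := hq.trans (pow_le_pow_of_le_one (by linarith) (by linarith) (Nat.sub_le m 1))
  have hPup : binMass (l - 1) (k n) ≤ binMass l (k n) := by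
    refine le_of_mul_le_mul_left ?_ hl'
    rw [hpred]; nlinarith
  have hPlow : binMass l (k n) / 2 ≤ binMass (l - 1) (k n) := by
    refine le_of_mul_le_mul_left ?_ hl'
    rw [hpred]; nlinarith
  -- `x` is the common influence of the bits in tribes, multiplied by their number
  set x := m * l * (F * binMass (l - 1) (k n)) with hx
  have hxlow : β * (b * d / 2) ≤ x := by
    have h2 : b * d / 2 ≤ m * l * binMass (l - 1) (k n) := by
      nlinarith [mul_le_mul_of_nonneg_left hPlow (mul_pos hm' hl').le]
    calc β * (b * d / 2) ≤ F * (m * l * binMass (l - 1) (k n)) :=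
          mul_le_mul hFβ h2 (by positivity) (hβ.le.trans hFβ)
      _ = x := by rw [hx]; ring
  have hxup : x ≤ 8 * d * L := by
    calc x = F * (m * l * binMass (l - 1) (k n)) := by rw [hx]; ring
      _ ≤ 1 * (m * l * binMass l (k n)) :=
          mul_le_mul hF1 (mul_le_mul_of_nonneg_left hPup (by positivity)) (by positivity)
            zero_le_one
      _ ≤ _ := by rw [one_mul]; exact hM.2
  have hxsq : (m * l : ℝ) * (F * binMass (l - 1) (k n)) ^ 2 = x ^ 2 / (m * l) := by
    rw [hx]; field_simp
  have hx0 : 0 ≤ β * (b * d / 2) := by positivity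
  have hlow2 := pow_le_pow_left₀ hx0 hxlow 2
  have hup2 := pow_le_pow_left₀ (hx0.trans hxlow) hxup 2
  have hpow : Real.log n / (n : ℝ) ^ (1 - lam) = (n : ℝ) ^ lam * Real.log n / n := by
    rw [Real.rpow_sub hn', Real.rpow_one]; field_simp
  have hlam1 : 0 < 1 - lam := by linarith
  rw [hxsq, hpow]
  constructor
  · rw [mul_div_assoc', le_div_iff₀ (by positivity), div_mul_eq_mul_div, div_le_iff₀ hn']
    have h2 : (n : ℝ) ^ lam / 2 * Real.log n ≤ l * Real.log n :=
      mul_le_mul_of_nonneg_right hlb.1 hlog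
    have h3 : (1 - lam) / 8 * ((n : ℝ) ^ lam / 2 * Real.log n) ≤ d ^ 2 :=
      (mul_le_mul_of_nonneg_left h2 (by positivity)).trans hd.2.1
    have h4 : (β * b / 2) ^ 2 * ((1 - lam) / 8 * ((n : ℝ) ^ lam / 2 * Real.log n)) ≤ x ^ 2 := by
      refine le_trans ?_ hlow2
      rw [show β * (b * d / 2) = β * b / 2 * d by ring, mul_pow _ d]
      exact mul_le_mul_of_nonneg_left h3 (sq_nonneg _)
    calc _ = (β * b / 2) ^ 2 * ((1 - lam) / 8 * ((n : ℝ) ^ lam / 2 * Real.log n)) * (m * l) := by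
          ring
      _ ≤ x ^ 2 * n := mul_le_mul h4 hml (by positivity) (sq_nonneg _)
  · rw [mul_div_assoc', div_le_iff₀ (by positivity), div_mul_eq_mul_div, le_div_iff₀ hn']
    have h2 : l * Real.log n ≤ (n : ℝ) ^ lam * Real.log n :=
      mul_le_mul_of_nonneg_right hlb.2 hlog
    have h3 : d ^ 2 ≤ 4 * ((n : ℝ) ^ lam * Real.log n) := by linarith [hd.2.2]
    have h4 : x ^ 2 ≤ 256 * L ^ 2 * ((n : ℝ) ^ lam * Real.log n) := by
      calc x ^ 2 ≤ (8 * d * L) ^ 2 := hup2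
        _ = 64 * L ^ 2 * d ^ 2 := by ring
        _ ≤ 64 * L ^ 2 * (4 * ((n : ℝ) ^ lam * Real.log n)) :=
          mul_le_mul_of_nonneg_left h3 (by positivity)
        _ = _ := by ring
    calc x ^ 2 * n ≤ 256 * L ^ 2 * ((n : ℝ) ^ lam * Real.log n) * (2 * (m * l)) :=
          mul_le_mul h4 hml' hn'.le (by positivity)
      _ = _ := by ring

end Quantile

end PolyTribes

theorem proposition2p1 (lam β : ℝ) (hlam0 : 0 < lam) (hlam1 : lam < 1)
    (hβ0 : 0 < β) (hβ1 : β < 1) :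
    ∃ c C : ℝ, 0 < c ∧ 0 < C ∧
      ∀ q : ℕ → ℝ,
        (∀ n : ℕ, 1 ≤ n →
          PolyTribes.IsQuantile
            (fun ω : PolyTribes.Cube n => (PolyTribes.maxTribe lam ω : ℝ)) β (q n)) →
        Tendsto (fun n : ℕ =>
            PolyTribes.prob {ω : PolyTribes.Cube n | PolyTribes.tribesFun lam (q n) ω = false})
          atTop (𝓝 β) ∧
        PolyTribes.NoiseSensitive
          (fun (n : ℕ) (ω : PolyTribes.Cube n) => PolyTribes.tribesFun lam (q n) ω) ∧
        ∀ᶠ n : ℕ in atTop,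
          c * (Real.log n / (n : ℝ) ^ (1 - lam)) ≤
              ∑ i : Fin n, PolyTribes.influence
                (fun ω : PolyTribes.Cube n => PolyTribes.tribesFun lam (q n) ω) i ^ 2 ∧
          ∑ i : Fin n, PolyTribes.influence
                (fun ω : PolyTribes.Cube n => PolyTribes.tribesFun lam (q n) ω) i ^ 2 ≤
            C * (Real.log n / (n : ℝ) ^ (1 - lam)) := by
  have hb0 : 0 < 1 - β := by linarith
  have hL0 : 0 < -Real.log β := neg_pos.2 (Real.log_neg hβ0 hβ1)
  have hlam : 0 < 1 - lam := by linarith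
  refine ⟨(1 - β) ^ 2 * β ^ 2 * (1 - lam) / 64, 512 * (-Real.log β) ^ 2, by positivity,
    by positivity, fun q hq => ?_⟩
  have hfloor := fun (n : ℕ) (hn : 1 ≤ n) =>
    (hq n hn).floor hβ0 (PolyTribes.tribeCount_pos hlam0.le hlam1.le hn).ne'
  have hge : ∀ᶠ n : ℕ in atTop, β ≤ (1 - PolyTribes.binTail (PolyTribes.tribeSize lam n)
      (⌊q n⌋₊ + 1)) ^ PolyTribes.tribeCount lam n :=
    (eventually_ge_atTop 1).mono fun n hn => (hfloor n hn).1
  have hb : ∀ᶠ n : ℕ in atTop, 1 - β ≤ PolyTribes.tribeCount lam n *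
      PolyTribes.binTail (PolyTribes.tribeSize lam n) ⌊q n⌋₊ := by
    filter_upwards [eventually_ge_atTop 1] with n hn
    have h1 := (hfloor n hn).2.1
    have h2 := one_add_mul_le_pow (a := -PolyTribes.binTail (PolyTribes.tribeSize lam n) ⌊q n⌋₊)
      (by linarith [PolyTribes.binTail_le_one (PolyTribes.tribeSize lam n) ⌊q n⌋₊])
      (PolyTribes.tribeCount lam n)
    rw [← sub_eq_add_neg] at h2
    linarith
  have hL : ∀ᶠ n : ℕ in atTop, PolyTribes.tribeCount lam n *
      PolyTribes.binTail (PolyTribes.tribeSize lam n) (⌊q n⌋₊ + 1) ≤ -Real.log β := by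
    filter_upwards [hge] with n hn
    have h1 := PolyTribes.binTail_le_one (PolyTribes.tribeSize lam n) (⌊q n⌋₊ + 1)
    have h2 := hn.trans (pow_le_pow_left₀ (by linarith) (Real.one_sub_le_exp_neg _) _)
    rw [← Real.exp_nat_mul] at h2
    have h3 := Real.log_le_log hβ0 h2
    rw [Real.log_exp] at h3
    linarith
  refine ⟨?_, fun ε hε0 hε1 => ?_, ?_⟩
  · have hlim := (PolyTribes.tendsto_tribeCount_mul_binMass hlam0 hlam1 hb0 hb hL).const_add β
    rw [add_zero] at hlim
    have hprob : ∀ n : ℕ, 1 ≤ n →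
        PolyTribes.prob {ω : PolyTribes.Cube n | PolyTribes.tribesFun lam (q n) ω = false} =
        (1 - PolyTribes.binTail (PolyTribes.tribeSize lam n) (⌊q n⌋₊ + 1)) ^
          PolyTribes.tribeCount lam n := by
      intro n hn
      simp only [(hfloor n hn).2.2]
      exact PolyTribes.prob_forall_block_le _ _
    refine tendsto_of_tendsto_of_tendsto_of_le_of_le' tendsto_const_nhds hlim ?_ ?_
    · filter_upwards [hge, eventually_ge_atTop 1] with n h hn
      rwa [hprob n hn]
    · filter_upwards [eventually_ge_atTop 1] with n hn
      rw [hprob n hn]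
      have h1 := (hfloor n hn).2.1
      set l := PolyTribes.tribeSize lam n
      have h2 := PolyTribes.binTail_eq_add l ⌊q n⌋₊
      have h3 := PolyTribes.binTail_le_one l ⌊q n⌋₊
      have h4 := PolyTribes.binTail_nonneg l (⌊q n⌋₊ + 1)
      have h5 := PolyTribes.binMass_nonneg l ⌊q n⌋₊
      have h6 := (le_abs_self _).trans (PolyTribes.abs_pow_sub_pow_le_mul
        (a := 1 - PolyTribes.binTail l (⌊q n⌋₊ + 1)) (b := 1 - PolyTribes.binTail l ⌊q n⌋₊)
        (by linarith) (by linarith) (by linarith) (by linarith) (PolyTribes.tribeCount lam n))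
      rw [h2, show ∀ x y : ℝ, 1 - x - (1 - (y + x)) = y from fun x y => by ring,
        abs_of_nonneg h5, ← h2] at h6
      linarith
  · refine (PolyTribes.tendsto_noise_covariance hε0 hε1 hlam0 hlam1 hb0 hb hL).congr' ?_
    filter_upwards [eventually_ge_atTop 1] with n hn
    exact (PolyTribes.noise_covariance _ (hfloor n hn).2.2 ε).symm
  · filter_upwards [PolyTribes.influence_sum_bounds hβ0 hlam0 hlam1 hb0 hb hL hge,
      eventually_ge_atTop 1] with n h hn
    rwa [PolyTribes.sum_influence_sq _ (hfloor n hn).2.2]
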